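/- Let $X_1,X_2,\dots$ be i.i.d. nonnegative random variables with distribution $F$, let $\alpha\in(0,1)$, and let $z=z_{\alpha/2}$ be the upper $(\alpha/2)$-quantile of the standard normal distribution. Put $\mu=E(X_1)$, $\sigma^2=V(X_1)$, $\Delta=E|X_1-X_2|$, $\tau=E(X_1|X_1-X_2|)$, $\sigma_1^2=V\big(E(|X_1-X_2|\mid X_1)\big)$, and $$\xi^2=\frac{\Delta^2}{4\mu^4}\sigma^2-\frac{\Delta\tau}{\mu^3}+\frac{\Delta^2}{\mu^2}+\frac{\sigma_1^2}{\mu^2},$$ the asymptotic variance of the sample Gini index. For a sample $X_1,\dots,X_n$ let $\overline X_n$ be the sample mean, $S_n^2$ the sample variance (with divisor $n-1$), $$\widehat\Delta_n=\binom n2^{-1}\sum_{1\le i<k\le n}|X_i-X_k|,\qquad \widehat\Delta_n^{(j)}=\binom{n-1}2^{-1}\sum_{\substack{1\le i<k\le n\\ i,k\ne j}}|X_i-X_k|,$$ $$\widehat\tau_n=\frac{2}{n(n-1)}\sum_{1\le i<k\le n}\tfrac12(X_i+X_k)|X_i-X_k|,\qquad W_{jn}=n\widehat\Delta_n-(n-2)\widehat\Delta_n^{(j)},$$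 $$\overline W_n=\frac1n\sum_{j=1}^nW_{jn},\qquad s_{wn}^2=\frac1{n-1}\sum_{j=1}^n\big(W_{jn}-\overline W_n\big)^2,$$ $$V_n^2=\frac{\widehat\Delta_n^2S_n^2}{4\overline X_n^4}-\frac{\widehat\Delta_n}{\overline X_n^3}\widehat\tau_n+\frac{\widehat\Delta_n^2}{\overline X_n^2}+\frac{s_{wn}^2}{4\overline X_n^2},$$ where quotients with $\overline X_n=0$ (all observations zero) are read as $0$. For $d>0$ let $N_d$ be the smallest integer $n\ge\max\{4,z/d\}$ with $$n\ge\Big(\frac zd\Big)^2\Big(V_n^2+\frac1n\Big)$$ ($N_d=\infty$ if there is none), and let $C=\lfloor z^2\xi^2/d^2\rfloor+1$. Assume $\xi^2>0$ and $E[X_1^4]<\infty$, and assume that either * $E[X_1^{-\beta}]<\infty$ for some $\beta>4$, or * for some integer $m\ge4$, the expectations $E\big[\sup_{n\ge m}s_{wn}^2\overline X_n^{-2}\big]$, $E\big[\sup_{n\ge m}\widehat\tau_n\overline X_n^{-2}\big]$ and $E\big[\sup_{n\ge m}S_n^2\overline X_n^{-2}\big]$ are finite. Then (i) $N_d/C\to1$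 almost surely as $d\downarrow0$; (ii) $E(N_d/C)\to1$ as $d\downarrow0$. -/

import Mathlib

open MeasureTheory ProbabilityTheory Filter Topology
open scoped ENNReal

namespace GiniSeq

noncomputable section

/-! ### Population quantities of the income distribution `F` -/

/-- The mean `μ = E X`. -/
def mean (F : Measure ℝ) : ℝ := ∫ x, x ∂F

/-- The first projection of the mean difference kernel, `x ↦ E|x - X|`, which is
`E(|X₁ - X₂| | X₁ = x)` for independent `X₁, X₂ ∼ F`. -/
def absDevFrom (F : Measure ℝ) (x : ℝ) : ℝ := ∫ y, |x - y| ∂F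

/-- Gini's mean difference `Δ = E|X₁ - X₂|`, with `X₁, X₂ ∼ F` independent. -/
def meanDiff (F : Measure ℝ) : ℝ := ∫ p, |p.1 - p.2| ∂(F.prod F)

/-- `τ = E(X₁ |X₁ - X₂|)`, with `X₁, X₂ ∼ F` independent. -/
def tau (F : Measure ℝ) : ℝ := ∫ p, p.1 * |p.1 - p.2| ∂(F.prod F)

/-- `σ² = V(X)`. -/
def sigmaSq (F : Measure ℝ) : ℝ := variance (fun x : ℝ => x) F

/-- `σ₁² = V(E(|X₁ - X₂| | X₁))`. -/
def sigmaOneSq (F : Measure ℝ) : ℝ := variance (absDevFrom F) F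

/-- The asymptotic variance `ξ²` of the sample Gini index. -/
def xiSq (F : Measure ℝ) : ℝ :=
  meanDiff F ^ 2 / (4 * mean F ^ 4) * sigmaSq F - meanDiff F * tau F / mean F ^ 3
    + meanDiff F ^ 2 / mean F ^ 2 + sigmaOneSq F / mean F ^ 2

/-! ### Sample quantities

A sample of size `n` consists of the first `n` terms `x 0, …, x (n - 1)` of a sequence `x`. -/

/-- The pairs `(i, j)` of indices in `s` with `i < j`. -/
def pairs (s : Finset ℕ) : Finset (ℕ × ℕ) := (s ×ˢ s).filter fun p => p.1 < p.2

/-- Gini's mean difference of the observations with index in `s`. -/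
def gmdOn (x : ℕ → ℝ) (s : Finset ℕ) : ℝ :=
  ((s.card.choose 2 : ℕ) : ℝ)⁻¹ * ∑ p ∈ pairs s, |x p.1 - x p.2|

/-- The sample Gini mean difference of the first `n` observations. -/
def sampleGmd (x : ℕ → ℝ) (n : ℕ) : ℝ := gmdOn x (Finset.range n)

/-- The sample Gini mean difference of the first `n` observations with the `j`-th one left out. -/
def sampleGmdLeaveOut (x : ℕ → ℝ) (n j : ℕ) : ℝ := gmdOn x ((Finset.range n).erase j)

/-- The sample mean. -/
def sampleMean (x : ℕ → ℝ) (n : ℕ) : ℝ := (∑ i ∈ Finset.range n, x i) / n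

/-- The (unbiased) sample variance `S_n²`. -/
def sampleVar (x : ℕ → ℝ) (n : ℕ) : ℝ :=
  (∑ i ∈ Finset.range n, (x i - sampleMean x n) ^ 2) / ((n : ℝ) - 1)

/-- The jackknife quantities `W_{jn}`. -/
def jackW (x : ℕ → ℝ) (n j : ℕ) : ℝ :=
  (n : ℝ) * sampleGmd x n - ((n : ℝ) - 2) * sampleGmdLeaveOut x n j

/-- The average of the `W_{jn}`, `j = 1, …, n`. -/
def jackWMean (x : ℕ → ℝ) (n : ℕ) : ℝ := (∑ j ∈ Finset.range n, jackW x n j) / n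

/-- The jackknife estimator `s_{wn}²` of `4 σ₁²`. -/
def jackVar (x : ℕ → ℝ) (n : ℕ) : ℝ :=
  (∑ j ∈ Finset.range n, (jackW x n j - jackWMean x n) ^ 2) / ((n : ℝ) - 1)

/-- The estimator of `τ`. -/
def sampleTau (x : ℕ → ℝ) (n : ℕ) : ℝ :=
  2 / ((n : ℝ) * ((n : ℝ) - 1)) *
    ∑ p ∈ pairs (Finset.range n), 1 / 2 * (x p.1 + x p.2) * |x p.1 - x p.2|

/-- The estimator `V_n²` of `ξ²`. It need not be nonnegative. -/
def sampleXiSq (x : ℕ → ℝ) (n : ℕ) : ℝ :=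
  sampleGmd x n ^ 2 * sampleVar x n / (4 * sampleMean x n ^ 4)
    - sampleGmd x n / sampleMean x n ^ 3 * sampleTau x n
    + sampleGmd x n ^ 2 / sampleMean x n ^ 2
    + jackVar x n / (4 * sampleMean x n ^ 2)

/-! ### The sequential procedure -/

/-- The upper `p`-th quantile of the standard normal distribution, `0 < p < 1`. -/
def upperNormalQuantile (p : ℝ) : ℝ := sInf {x : ℝ | 1 - p ≤ cdf (gaussianReal 0 1) x}

/-- The optimal fixed sample size `C`, for half-width `d` and normal quantile `z`. -/
def optimalSize (F : Measure ℝ) (z d : ℝ) : ℕ := ⌊z ^ 2 * xiSq F / d ^ 2⌋₊ + 1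

/-- The final sample size `N_d` on the data `x`: the smallest integer `n ≥ max {4, z/d}` with
`n ≥ (z/d)² (V_n² + 1/n)`, and `∞` if there is none. -/
def stopTime (z d : ℝ) (x : ℕ → ℝ) : ℕ∞ :=
  ⨅ (n : ℕ) (_ : max 4 (z / d) ≤ (n : ℝ) ∧
    (z / d) ^ 2 * (sampleXiSq x n + 1 / (n : ℝ)) ≤ (n : ℝ)), (n : ℕ∞)

end

end GiniSeq

/-!
Everything rests on `V_n² → ξ²` almost surely and on the integrability of `sup_{n ≥ m} V_n²`.

*Reduction.* Along a sequence with `V_n² → ξ² > 0`, the stopping rule gives `d² N_d → z² ξ²`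
(`tendsto_sq_mul_stopTime`), while `d² C → z² ξ²`; this is (i). Sampling has stopped once `n`
exceeds `m`, `4`, `z/d` and `(z/d)² (sup_{n ≥ m} V_n² + 1)`, so for `d ≤ z` the ratio `N_d / C` is
bounded by an affine function of the supremum (`stopTime_div_optimalSize_le`), and (ii) follows
from (i) by dominated convergence.

*Consistency.* With `G_n t` the mean distance from `t` to the first `n` observations, all the
U-statistics in `V_n²` are averages along the sample: up to powers of `n / (n - 1)`, `Δ̂_n` is the
average of `G_n(X_j)`, `τ̂_n` that of `X_j G_n(X_j)`, and `W_{jn} = 2 G_n(X_j)`. Since `G_n` and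
`g t = E|t - X|` are `1`-Lipschitz with controlled behaviour at infinity, the strong law on
rational grids makes `G_n → g` uniformly on `[0, ∞)` (`eventually_abs_sub_le_of_isMeanAbsDev`).
Thus `G_n` may be replaced by `g`, and the strong law for independent variables suffices
(`tendsto_sampleXiSq`, `ae_tendsto_sampleXiSq`).

*Supremum.* For nonnegative data `Δ̂_n ≤ 4 X̄_n` and `τ̂_n ≥ 0`, whence `V_n² ≤ 16 + 4 S_n² /
X̄_n² + s_{wn}² / X̄_n²` (`sampleXiSq_le`), which settles the second alternative of the
hypothesis. Under the first one, both `S_n²` and `s_{wn}²` are at most a multiple of the average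
`A_n` of the `X_i²`, and `X̄_n⁻²` is at most the average `B_n` of the `X_i⁻²` by Jensen's
inequality. As `A_n B_n ≤ A_n² + B_n²`, it suffices that `sup A_n²` and `sup B_n²` are integrable,
which holds because `X²` and `X⁻²` are square integrable (`lintegral_iSup_sq_sampleMean_lt_top`).
-/

namespace GiniSeq

/-! ### The normal quantile -/

lemma cdf_gaussianReal_zero_le_half : cdf (gaussianReal 0 1) 0 ≤ 1 / 2 := by
  have hmap : (gaussianReal 0 1).real (Set.Ici 0) = (gaussianReal 0 1).real (Set.Iic 0) := by
    have h : (gaussianReal 0 1).map (fun x : ℝ => -x) = gaussianReal 0 1 := by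
      rw [gaussianReal_map_neg, neg_zero]
    nth_rw 2 [← h]
    rw [map_measureReal_apply measurable_neg measurableSet_Iic]
    congr 1
    ext x
    simp
  have : NullSingletonClass (gaussianReal 0 1) := nullSingletonClass_gaussianReal one_ne_zero
  have hIci : (gaussianReal 0 1).real (Set.Ici 0) = (gaussianReal 0 1).real (Set.Ioi 0) :=
    measureReal_congr Ioi_ae_eq_Ici.symm
  have hsum : (gaussianReal 0 1).real (Set.Iic 0) + (gaussianReal 0 1).real (Set.Ioi 0) = 1 := by
    rw [← Set.compl_Iic]
    exact probReal_add_probReal_compl measurableSet_Iic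
  rw [cdf_eq_real]
  linarith

/-- The upper `p`-quantile is positive for `p < 1/2`. The set defining it is nonempty, so that the
infimum is not a junk value, and right continuity of the distribution function at `0` keeps the set
away from `0`. -/
lemma upperNormalQuantile_pos {p : ℝ} (hp0 : 0 < p) (hp : p < 1 / 2) :
    0 < upperNormalQuantile p := by
  have hlt : cdf (gaussianReal 0 1) 0 < 1 - p := by
    have := cdf_gaussianReal_zero_le_half
    linarith
  have hright : ∀ᶠ x in 𝓝[>] (0 : ℝ), cdf (gaussianReal 0 1) x < 1 - p :=
    (((cdf (gaussianReal 0 1)).right_continuous 0).mono_left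
      (nhdsWithin_mono _ Set.Ioi_subset_Ici_self)).eventually_lt_const hlt
  obtain ⟨δ, hδ, hδ0⟩ := (hright.and self_mem_nhdsWithin).exists
  have hne : {x : ℝ | 1 - p ≤ cdf (gaussianReal 0 1) x}.Nonempty :=
    ((tendsto_cdf_atTop (gaussianReal 0 1)).eventually_const_le (by linarith)).exists
  refine lt_of_lt_of_le (Set.mem_Ioi.1 hδ0) (le_csInf hne fun x hx => ?_)
  by_contra! hxδ
  exact absurd (monotone_cdf (gaussianReal 0 1) hxδ.le) (not_le.2 (hδ.trans_le hx))

/-! ### The stopping rule along a fixed sequence of observations -/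

/-- The stopping criterion at sample size `n`. -/
def Stops (z d : ℝ) (x : ℕ → ℝ) (n : ℕ) : Prop :=
  max 4 (z / d) ≤ (n : ℝ) ∧ (z / d) ^ 2 * (sampleXiSq x n + 1 / (n : ℝ)) ≤ (n : ℝ)

lemma stopTime_le {z d : ℝ} {x : ℕ → ℝ} {n : ℕ} (h : Stops z d x n) : stopTime z d x ≤ n :=
  iInf₂_le n h

lemma stopTime_eq_coe_iff {z d : ℝ} {x : ℕ → ℝ} {n : ℕ} :
    stopTime z d x = n ↔ Stops z d x n ∧ ∀ k < n, ¬ Stops z d x k := by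
  classical
  constructor
  · intro h
    have hex : ∃ k, Stops z d x k := by
      by_contra! hno
      have : stopTime z d x = ⊤ := by
        simp only [stopTime, iInf_eq_top]
        exact fun k hk => absurd hk (hno k)
      rw [h] at this
      exact ENat.natCast_ne_top n this
    have hmin : stopTime z d x = (Nat.find hex : ℕ∞) :=
      le_antisymm (stopTime_le (Nat.find_spec hex))
        (le_iInf₂ fun k hk => Nat.cast_le.2 (Nat.find_min' hex hk))
    have hn : n = Nat.find hex := by
      rw [h] at hmin
      exact_mod_cast hmin
    rw [hn]
    exact ⟨Nat.find_spec hex, fun k hk => Nat.find_min hex hk⟩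
  · rintro ⟨hn, hmin⟩
    refine le_antisymm (stopTime_le hn) (le_iInf₂ fun k hk => Nat.cast_le.2 ?_)
    by_contra! hkn
    exact hmin k hkn hk

/-- If the variance estimate stays below `K` from sample size `m` on, sampling stops by the time the
sample size reaches `m`, `4`, `z/d` and `(z/d)² K`. -/
lemma exists_stopTime_eq {z d K : ℝ} {x : ℕ → ℝ} {m : ℕ} (hz : 0 < z) (hd : 0 < d) (hK : 0 ≤ K)
    (h : ∀ n ≥ m, sampleXiSq x n + 1 / (n : ℝ) ≤ K) :
    ∃ n : ℕ, stopTime z d x = n ∧ (n : ℝ) ≤ m + 5 + z / d + (z / d) ^ 2 * K := by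
  have hzd : 0 < z / d := div_pos hz hd
  have hB : 0 ≤ (m : ℝ) + 4 + z / d + (z / d) ^ 2 * K := by positivity
  set k := ⌈(m : ℝ) + 4 + z / d + (z / d) ^ 2 * K⌉₊ with hk
  have hle : (m : ℝ) + 4 + z / d + (z / d) ^ 2 * K ≤ k := Nat.le_ceil _
  have hlt : (k : ℝ) < (m : ℝ) + 4 + z / d + (z / d) ^ 2 * K + 1 := Nat.ceil_lt_add_one hB
  have hK' : 0 ≤ (z / d) ^ 2 * K := by positivity
  have hm : (0 : ℝ) ≤ m := Nat.cast_nonneg m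
  have hmk : m ≤ k := by
    have : (m : ℝ) ≤ k := by linarith
    exact_mod_cast this
  have hcrit : Stops z d x k :=
    ⟨max_le (by linarith) (by linarith),
      (mul_le_mul_of_nonneg_left (h k hmk) (by positivity)).trans (by linarith)⟩
  have hst : stopTime z d x ≤ k := stopTime_le hcrit
  obtain ⟨n, hn⟩ := ENat.ne_top_iff_exists.1 (ne_top_of_le_ne_top (ENat.natCast_ne_top k) hst)
  refine ⟨n, hn.symm, ?_⟩
  rw [← hn] at hst
  have : (n : ℝ) ≤ k := by exact_mod_cast hst
  linarith

lemma le_optimalSize (F : Measure ℝ) (z d : ℝ) : z ^ 2 * xiSq F / d ^ 2 ≤ optimalSize F z d := by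
  rw [optimalSize, Nat.cast_add, Nat.cast_one]
  exact (Nat.lt_floor_add_one _).le

lemma tendsto_sq_mul_optimalSize {F : Measure ℝ} {z : ℝ} (hxi : 0 < xiSq F) :
    Tendsto (fun d : ℝ => d ^ 2 * (optimalSize F z d : ℝ)) (𝓝[>] 0) (𝓝 (z ^ 2 * xiSq F)) := by
  have hupper : Tendsto (fun d : ℝ => z ^ 2 * xiSq F + d ^ 2) (𝓝[>] 0) (𝓝 (z ^ 2 * xiSq F)) := by
    have : Tendsto (fun d : ℝ => z ^ 2 * xiSq F + d ^ 2) (𝓝 0) (𝓝 (z ^ 2 * xiSq F + 0 ^ 2)) :=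
      Continuous.tendsto (by fun_prop) 0
    simpa using this.mono_left nhdsWithin_le_nhds
  refine tendsto_of_tendsto_of_tendsto_of_le_of_le' tendsto_const_nhds hupper ?_ ?_
  · filter_upwards [self_mem_nhdsWithin] with d hd
    have hd : 0 < d := hd
    have := le_optimalSize F z d
    rwa [div_le_iff₀ (by positivity), mul_comm _ (d ^ 2)] at this
  · filter_upwards [self_mem_nhdsWithin] with d hd
    have hd : 0 < d := hd
    have h : (optimalSize F z d : ℝ) ≤ z ^ 2 * xiSq F / d ^ 2 + 1 := by
      rw [optimalSize, Nat.cast_add, Nat.cast_one]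
      gcongr
      exact Nat.floor_le (by positivity)
    calc d ^ 2 * (optimalSize F z d : ℝ) ≤ d ^ 2 * (z ^ 2 * xiSq F / d ^ 2 + 1) := by gcongr
      _ = z ^ 2 * xiSq F + d ^ 2 := by field_simp

/-- Along a sequence for which `V_n²` converges to `v > 0`, `d² N_d` converges to `z² v`. The upper
bound is `exists_stopTime_eq`; for the lower bound, `N_d ≥ z/d` forces `N_d` into the range where
`V_n²` is close to `v`. -/
lemma tendsto_sq_mul_stopTime {z v : ℝ} {x : ℕ → ℝ} (hz : 0 < z) (hv : 0 < v)
    (h : Tendsto (sampleXiSq x) atTop (𝓝 v)) :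
    Tendsto (fun d : ℝ => d ^ 2 * ((stopTime z d x).toNat : ℝ)) (𝓝[>] 0) (𝓝 (z ^ 2 * v)) := by
  have hone : Tendsto (fun n : ℕ => sampleXiSq x n + 1 / (n : ℝ)) atTop (𝓝 v) := by
    simpa using h.add tendsto_one_div_atTop_nhds_zero_nat
  have hz2 : 0 < z ^ 2 := by positivity
  rw [tendsto_order]
  constructor
  · intro a ha
    have hav : a / z ^ 2 < v := by rwa [div_lt_iff₀ hz2, mul_comm]
    obtain ⟨m, hm⟩ := eventually_atTop.1 (hone.eventually_const_lt hav)
    obtain ⟨m', hm'⟩ := eventually_atTop.1 (hone.eventually_le_const (lt_add_one v))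
    have hbig : ∀ᶠ d in 𝓝[>] (0 : ℝ), (m : ℝ) ≤ z / d := by
      have : Tendsto (fun d : ℝ => z / d) (𝓝[>] 0) atTop := by
        simpa [div_eq_mul_inv] using tendsto_inv_nhdsGT_zero.const_mul_atTop hz
      exact this.eventually_ge_atTop _
    filter_upwards [self_mem_nhdsWithin, hbig] with d hd hmd
    have hd : 0 < d := hd
    obtain ⟨n, hn, -⟩ := exists_stopTime_eq hz hd (by linarith) hm'
    obtain ⟨⟨h1, h2⟩, -⟩ := stopTime_eq_coe_iff.1 hn
    have hmn : m ≤ n := by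
      have : (m : ℝ) ≤ n := hmd.trans ((le_max_right _ _).trans h1)
      exact_mod_cast this
    rw [hn, ENat.toNat_natCast]
    have h3 := hm n hmn
    rw [div_pow, div_mul_eq_mul_div, div_le_iff₀ (by positivity)] at h2
    rw [div_lt_iff₀ hz2] at h3
    linarith
  · intro b hb
    have hbv : v < b / z ^ 2 := by rwa [lt_div_iff₀ hz2, mul_comm]
    obtain ⟨K, hvK, hKb⟩ := exists_between hbv
    obtain ⟨m, hm⟩ := eventually_atTop.1 (hone.eventually_le_const hvK)
    have hlim : Tendsto (fun d : ℝ => d ^ 2 * (m + 5) + d * z + z ^ 2 * K) (𝓝[>] 0)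
        (𝓝 (z ^ 2 * K)) := by
      have : Tendsto (fun d : ℝ => d ^ 2 * (m + 5) + d * z + z ^ 2 * K) (𝓝 0)
          (𝓝 ((0 : ℝ) ^ 2 * (m + 5) + 0 * z + z ^ 2 * K)) :=
        Continuous.tendsto (by fun_prop) 0
      simpa using this.mono_left nhdsWithin_le_nhds
    rw [lt_div_iff₀ hz2, mul_comm] at hKb
    filter_upwards [self_mem_nhdsWithin, hlim.eventually_lt_const hKb] with d hd hdb
    have hd : 0 < d := hd
    obtain ⟨n, hn, hnle⟩ := exists_stopTime_eq hz hd (by linarith) hm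
    rw [hn, ENat.toNat_natCast]
    refine lt_of_le_of_lt ?_ hdb
    calc d ^ 2 * (n : ℝ) ≤ d ^ 2 * (m + 5 + z / d + (z / d) ^ 2 * K) := by gcongr
      _ = d ^ 2 * (m + 5) + d * z + z ^ 2 * K := by field_simp

lemma tendsto_stopTime_div_optimalSize {F : Measure ℝ} {z : ℝ} {x : ℕ → ℝ} (hz : 0 < z)
    (hxi : 0 < xiSq F) (h : Tendsto (sampleXiSq x) atTop (𝓝 (xiSq F))) :
    Tendsto (fun d : ℝ => (stopTime z d x : ℝ≥0∞) / (optimalSize F z d : ℝ≥0∞)) (𝓝[>] 0)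
      (𝓝 1) := by
  have hlim := (tendsto_sq_mul_stopTime hz hxi h).div (tendsto_sq_mul_optimalSize (z := z) hxi)
    (by positivity)
  rw [div_self (by positivity)] at hlim
  rw [← ENNReal.ofReal_one]
  refine (ENNReal.tendsto_ofReal hlim).congr' ?_
  have hone : Tendsto (fun n : ℕ => sampleXiSq x n + 1 / (n : ℝ)) atTop (𝓝 (xiSq F)) := by
    simpa using h.add tendsto_one_div_atTop_nhds_zero_nat
  obtain ⟨m, hm⟩ := eventually_atTop.1 (hone.eventually_le_const (lt_add_one (xiSq F)))
  filter_upwards [self_mem_nhdsWithin] with d hd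
  have hd : 0 < d := hd
  obtain ⟨n, hn, -⟩ := exists_stopTime_eq hz hd (by linarith) hm
  have hC : (0 : ℝ) < optimalSize F z d := by
    rw [optimalSize]
    positivity
  simp only [Pi.div_apply]
  rw [hn, ENat.toNat_natCast, ENat.toENNReal_coe, mul_div_mul_left _ _ (by positivity),
    ENNReal.ofReal_div_of_pos hC, ENNReal.ofReal_natCast, ENNReal.ofReal_natCast]

/-- For `d ≤ z` the ratio `N_d / C` is bounded by an affine function of `sup_{n ≥ m} V_n²`. -/
lemma stopTime_div_optimalSize_le {F : Measure ℝ} {z d : ℝ} {x : ℕ → ℝ} (hz : 0 < z) (hd : 0 < d)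
    (hdz : d ≤ z) (hxi : 0 < xiSq F) (m : ℕ) (hm : 1 ≤ m) :
    (stopTime z d x : ℝ≥0∞) / (optimalSize F z d : ℝ≥0∞) ≤
      ENNReal.ofReal (m + 5 + 2 / xiSq F) +
        ENNReal.ofReal (xiSq F)⁻¹ * ⨆ (n : ℕ) (_ : m ≤ n), ENNReal.ofReal (sampleXiSq x n) := by
  set S : ℝ≥0∞ := ⨆ (n : ℕ) (_ : m ≤ n), ENNReal.ofReal (sampleXiSq x n) with hS
  have hinv : 0 < (xiSq F)⁻¹ := inv_pos.2 hxi
  rcases eq_or_ne S ∞ with htop | htop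
  · rw [htop, ENNReal.mul_top (by simpa using hxi)]
    simp
  have hbound : ∀ n ≥ m, sampleXiSq x n + 1 / (n : ℝ) ≤ S.toReal + 1 := by
    intro n hn
    have h1 : sampleXiSq x n ≤ S.toReal :=
      (ENNReal.ofReal_le_iff_le_toReal htop).1
        (le_iSup₂ (f := fun (n : ℕ) (_ : m ≤ n) => ENNReal.ofReal (sampleXiSq x n)) n hn)
    have h2 : 1 / (n : ℝ) ≤ 1 := by
      have : (1 : ℝ) ≤ n := by exact_mod_cast hm.trans hn
      exact div_le_one_of_le₀ this (by positivity)
    linarith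
  obtain ⟨n, hn, hnle⟩ := exists_stopTime_eq hz hd (by positivity) hbound
  have hC := le_optimalSize F z d
  have hC1 : (1 : ℝ) ≤ optimalSize F z d := by
    rw [optimalSize]
    push_cast
    linarith [Nat.cast_nonneg (α := ℝ) ⌊z ^ 2 * xiSq F / d ^ 2⌋₊]
  have hCpos : (0 : ℝ) < optimalSize F z d := by linarith
  have key : (n : ℝ) / optimalSize F z d ≤ (m + 5 + 2 / xiSq F) + (xiSq F)⁻¹ * S.toReal := by
    rw [div_le_iff₀ hCpos]
    have hzd : 1 ≤ z / d := (one_le_div hd).2 hdz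
    have hzd2 : z / d ≤ (z / d) ^ 2 := le_self_pow₀ hzd two_ne_zero
    have hsq : (z / d) ^ 2 * xiSq F ≤ optimalSize F z d := by
      rw [div_pow, div_mul_eq_mul_div]
      exact hC
    have hsq' : (z / d) ^ 2 ≤ (xiSq F)⁻¹ * optimalSize F z d := by
      rw [inv_mul_eq_div, le_div_iff₀ hxi]
      exact hsq
    have hS0 : 0 ≤ S.toReal := ENNReal.toReal_nonneg
    calc (n : ℝ) ≤ m + 5 + z / d + (z / d) ^ 2 * (S.toReal + 1) := hnle
      _ ≤ (m + 5) * optimalSize F z d + (z / d) ^ 2 * (S.toReal + 2) := by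
          have : ((m : ℝ) + 5) * 1 ≤ (m + 5) * optimalSize F z d := by gcongr
          linarith
      _ ≤ (m + 5) * optimalSize F z d + (xiSq F)⁻¹ * optimalSize F z d * (S.toReal + 2) := by
          gcongr
      _ = _ := by
          field_simp
          ring
  calc (stopTime z d x : ℝ≥0∞) / (optimalSize F z d : ℝ≥0∞)
      = ENNReal.ofReal ((n : ℝ) / optimalSize F z d) := by
        rw [hn, ENat.toENNReal_coe, ENNReal.ofReal_div_of_pos hCpos, ENNReal.ofReal_natCast,
          ENNReal.ofReal_natCast]
    _ ≤ ENNReal.ofReal ((m + 5 + 2 / xiSq F) + (xiSq F)⁻¹ * S.toReal) :=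
        ENNReal.ofReal_le_ofReal key
    _ = _ := by
        rw [ENNReal.ofReal_add (by positivity) (by positivity), ENNReal.ofReal_mul hinv.le,
          ENNReal.ofReal_toReal htop]

/-! ### Sample statistics in terms of the empirical mean absolute deviation -/

/-- The empirical counterpart of `absDevFrom`: the mean distance from `t` to the first `n` terms of
`x`. -/
noncomputable def sampleAbsDevFrom (x : ℕ → ℝ) (n : ℕ) (t : ℝ) : ℝ :=
  sampleMean (fun i => |t - x i|) n

lemma sum_range_eq_mul_sampleMean {n : ℕ} (hn : n ≠ 0) (f : ℕ → ℝ) :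
    ∑ i ∈ Finset.range n, f i = n * sampleMean f n := by
  rw [sampleMean, mul_div_cancel₀ _ (by exact_mod_cast hn)]

lemma sampleMean_mono {f g : ℕ → ℝ} {n : ℕ} (h : ∀ i < n, f i ≤ g i) :
    sampleMean f n ≤ sampleMean g n :=
  div_le_div_of_nonneg_right (Finset.sum_le_sum fun i hi => h i (Finset.mem_range.1 hi))
    (Nat.cast_nonneg n)

lemma sampleMean_nonneg {f : ℕ → ℝ} {n : ℕ} (h : ∀ i < n, 0 ≤ f i) : 0 ≤ sampleMean f n :=
  div_nonneg (Finset.sum_nonneg fun i hi => h i (Finset.mem_range.1 hi)) (Nat.cast_nonneg n)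

lemma sampleMean_add (f g : ℕ → ℝ) (n : ℕ) :
    sampleMean (fun i => f i + g i) n = sampleMean f n + sampleMean g n := by
  simp only [sampleMean, Finset.sum_add_distrib, add_div]

lemma sampleMean_sub (f g : ℕ → ℝ) (n : ℕ) :
    sampleMean (fun i => f i - g i) n = sampleMean f n - sampleMean g n := by
  simp only [sampleMean, Finset.sum_sub_distrib, sub_div]

lemma sampleMean_const_mul (c : ℝ) (f : ℕ → ℝ) (n : ℕ) :
    sampleMean (fun i => c * f i) n = c * sampleMean f n := by
  simp only [sampleMean, ← Finset.mul_sum, mul_div_assoc]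

lemma sampleMean_const (c : ℝ) {n : ℕ} (hn : n ≠ 0) : sampleMean (fun _ => c) n = c := by
  have : (n : ℝ) ≠ 0 := by exact_mod_cast hn
  simp [sampleMean, this]

lemma abs_sampleMean_le (f : ℕ → ℝ) (n : ℕ) :
    |sampleMean f n| ≤ sampleMean (fun i => |f i|) n := by
  rw [sampleMean, sampleMean, abs_div, Nat.abs_cast]
  exact div_le_div_of_nonneg_right (Finset.abs_sum_le_sum_abs _ _) (Nat.cast_nonneg n)

lemma sampleMean_sq_sub_sampleMean (f : ℕ → ℝ) (n : ℕ) :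
    sampleMean (fun i => (f i - sampleMean f n) ^ 2) n =
      sampleMean (fun i => f i ^ 2) n - sampleMean f n ^ 2 := by
  rcases eq_or_ne n 0 with rfl | hn
  · simp [sampleMean]
  · have h : (fun i => (f i - sampleMean f n) ^ 2) =
        fun i => f i ^ 2 - 2 * sampleMean f n * f i + sampleMean f n ^ 2 := by
      ext i
      ring
    rw [h, sampleMean_add, sampleMean_sub, sampleMean_const_mul, sampleMean_const _ hn]
    ring

lemma sq_sampleMean_le (f : ℕ → ℝ) (n : ℕ) :
    sampleMean f n ^ 2 ≤ sampleMean (fun i => f i ^ 2) n := by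
  have := sampleMean_nonneg (f := fun i => (f i - sampleMean f n) ^ 2) (n := n)
    fun i _ => sq_nonneg _
  rw [sampleMean_sq_sub_sampleMean] at this
  linarith

lemma two_mul_sum_pairs {f : ℕ → ℕ → ℝ} (hsymm : ∀ i j, f i j = f j i) (hdiag : ∀ i, f i i = 0)
    (s : Finset ℕ) :
    2 * ∑ p ∈ pairs s, f p.1 p.2 = ∑ i ∈ s, ∑ j ∈ s, f i j := by
  have hlt : ∑ p ∈ pairs s, f p.1 p.2 = ∑ i ∈ s, ∑ j ∈ s, if i < j then f i j else 0 := by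
    rw [pairs, Finset.sum_filter, Finset.sum_product]
  have hgt : ∑ p ∈ pairs s, f p.1 p.2 = ∑ i ∈ s, ∑ j ∈ s, if j < i then f i j else 0 := by
    rw [hlt, Finset.sum_comm]
    simp only [hsymm]
  rw [two_mul]
  nth_rw 1 [hlt]
  rw [hgt, ← Finset.sum_add_distrib]
  refine Finset.sum_congr rfl fun i _ => ?_
  rw [← Finset.sum_add_distrib]
  refine Finset.sum_congr rfl fun j _ => ?_
  rcases lt_trichotomy i j with h | rfl | h
  · simp [h, h.not_gt]
  · simp [hdiag]
  · simp [h, h.not_gt]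

lemma gmdOn_eq (x : ℕ → ℝ) (s : Finset ℕ) :
    gmdOn x s = (∑ i ∈ s, ∑ j ∈ s, |x i - x j|) / ((s.card : ℝ) * (s.card - 1)) := by
  rw [gmdOn, ← two_mul_sum_pairs (f := fun i j => |x i - x j|) (fun i j => abs_sub_comm _ _)
    (by simp), Nat.cast_choose_two]
  rw [inv_div, div_mul_eq_mul_div]

lemma sum_sum_abs_sub {x : ℕ → ℝ} {n : ℕ} (hn : n ≠ 0) :
    ∑ i ∈ Finset.range n, ∑ j ∈ Finset.range n, |x i - x j| =
      n ^ 2 * sampleMean (fun i => sampleAbsDevFrom x n (x i)) n := by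
  have h (i : ℕ) : ∑ j ∈ Finset.range n, |x i - x j| = n * sampleAbsDevFrom x n (x i) :=
    sum_range_eq_mul_sampleMean hn _
  rw [Finset.sum_congr rfl fun i _ => h i, ← Finset.mul_sum, sum_range_eq_mul_sampleMean hn]
  ring

lemma sampleGmd_eq {x : ℕ → ℝ} {n : ℕ} (hn : n ≠ 0) :
    sampleGmd x n =
      (n : ℝ) / (n - 1) * sampleMean (fun i => sampleAbsDevFrom x n (x i)) n := by
  have : (n : ℝ) ≠ 0 := by exact_mod_cast hn
  rw [sampleGmd, gmdOn_eq, Finset.card_range, sum_sum_abs_sub hn, div_mul_eq_mul_div, pow_two,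
    mul_assoc, mul_div_mul_left _ _ this]

lemma sampleTau_eq {x : ℕ → ℝ} {n : ℕ} (hn : n ≠ 0) :
    sampleTau x n =
      (n : ℝ) / (n - 1) * sampleMean (fun i => x i * sampleAbsDevFrom x n (x i)) n := by
  have hn' : (n : ℝ) ≠ 0 := by exact_mod_cast hn
  have hinner (i : ℕ) : ∑ j ∈ Finset.range n, x i * |x i - x j| =
      n * (x i * sampleAbsDevFrom x n (x i)) := by
    rw [sum_range_eq_mul_sampleMean hn, sampleMean_const_mul, sampleAbsDevFrom]
  have hsum : ∑ i ∈ Finset.range n, ∑ j ∈ Finset.range n, 1 / 2 * (x i + x j) * |x i - x j| =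
      n ^ 2 * sampleMean (fun i => x i * sampleAbsDevFrom x n (x i)) n := by
    have hsplit : ∑ i ∈ Finset.range n, ∑ j ∈ Finset.range n, 1 / 2 * (x i + x j) * |x i - x j| =
        1 / 2 * ∑ i ∈ Finset.range n, ∑ j ∈ Finset.range n, x i * |x i - x j| +
        1 / 2 * ∑ i ∈ Finset.range n, ∑ j ∈ Finset.range n, x j * |x j - x i| := by
      simp only [Finset.mul_sum, ← Finset.sum_add_distrib]
      refine Finset.sum_congr rfl fun i _ => Finset.sum_congr rfl fun j _ => ?_
      rw [abs_sub_comm (x j)]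
      ring
    rw [hsplit, Finset.sum_comm (f := fun i j => x j * |x j - x i|),
      Finset.sum_congr rfl fun i _ => hinner i, ← Finset.mul_sum, sum_range_eq_mul_sampleMean hn]
    ring
  have h2 := two_mul_sum_pairs (f := fun i j => 1 / 2 * (x i + x j) * |x i - x j|)
    (fun i j => by rw [abs_sub_comm, add_comm]) (by simp) (Finset.range n)
  rw [hsum] at h2
  rw [sampleTau, div_mul_eq_mul_div, h2, div_mul_eq_mul_div, pow_two, mul_assoc,
    mul_div_mul_left _ _ hn']

lemma sampleVar_eq {x : ℕ → ℝ} {n : ℕ} (hn : n ≠ 0) :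
    sampleVar x n =
      (n : ℝ) / (n - 1) * (sampleMean (fun i => x i ^ 2) n - sampleMean x n ^ 2) := by
  rw [sampleVar, ← sampleMean_sq_sub_sampleMean, sum_range_eq_mul_sampleMean hn]
  ring

/-- Leaving out `x j` removes its distances to the other observations, so that `W_{jn}` is twice the
mean absolute deviation from `x j`, up to the factor `n / (n - 1)`. -/
lemma jackW_eq {x : ℕ → ℝ} {n j : ℕ} (hn : 3 ≤ n) (hj : j < n) :
    jackW x n j = 2 * ((n : ℝ) / (n - 1)) * sampleAbsDevFrom x n (x j) := by
  have hn0 : n ≠ 0 := by omega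
  have h3 : (3 : ℝ) ≤ n := by exact_mod_cast hn
  have hmem : j ∈ Finset.range n := Finset.mem_range.2 hj
  have hrow : ∑ i ∈ Finset.range n, |x j - x i| = n * sampleAbsDevFrom x n (x j) :=
    sum_range_eq_mul_sampleMean hn0 _
  have herase : ∑ i ∈ (Finset.range n).erase j, ∑ k ∈ (Finset.range n).erase j, |x i - x k| =
      ∑ i ∈ Finset.range n, ∑ k ∈ Finset.range n, |x i - x k| -
        2 * ∑ i ∈ Finset.range n, |x j - x i| := by
    have hcol : ∑ i ∈ Finset.range n, |x i - x j| = ∑ i ∈ Finset.range n, |x j - x i| :=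
      Finset.sum_congr rfl fun i _ => abs_sub_comm _ _
    simp only [Finset.sum_erase_eq_sub hmem, Finset.sum_sub_distrib, hcol, sub_self, abs_zero]
    ring
  rw [jackW, sampleGmd, sampleGmdLeaveOut, gmdOn_eq, gmdOn_eq, herase, hrow,
    Finset.card_erase_of_mem hmem, Finset.card_range, Nat.cast_pred (by omega)]
  have h1 : (n : ℝ) - 1 ≠ 0 := by linarith
  have h2 : (n : ℝ) - 1 - 1 ≠ 0 := by linarith
  have h0 : (n : ℝ) ≠ 0 := by linarith
  have h12 : (n : ℝ) - 2 = n - 1 - 1 := by ring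
  rw [h12]
  field_simp
  ring

lemma jackVar_eq {x : ℕ → ℝ} {n : ℕ} (hn : 3 ≤ n) :
    jackVar x n = 4 * ((n : ℝ) / (n - 1)) ^ 3 *
      (sampleMean (fun i => sampleAbsDevFrom x n (x i) ^ 2) n -
        sampleMean (fun i => sampleAbsDevFrom x n (x i)) n ^ 2) := by
  have hn0 : n ≠ 0 := by omega
  have hmean : jackWMean x n =
      2 * ((n : ℝ) / (n - 1)) * sampleMean (fun i => sampleAbsDevFrom x n (x i)) n := by
    rw [jackWMean, ← sampleMean_const_mul, sampleMean]
    congr 1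
    exact Finset.sum_congr rfl fun j hj => jackW_eq hn (Finset.mem_range.1 hj)
  have hterm (j : ℕ) (hj : j ∈ Finset.range n) : (jackW x n j - jackWMean x n) ^ 2 =
      (2 * ((n : ℝ) / (n - 1))) ^ 2 * (sampleAbsDevFrom x n (x j) -
        sampleMean (fun i => sampleAbsDevFrom x n (x i)) n) ^ 2 := by
    rw [hmean, jackW_eq hn (Finset.mem_range.1 hj)]
    ring
  rw [jackVar, Finset.sum_congr rfl hterm, ← Finset.mul_sum, sum_range_eq_mul_sampleMean hn0,
    sampleMean_sq_sub_sampleMean]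
  ring

/-! ### Deterministic bounds for nonnegative observations -/

lemma ratio_nonneg_le_two {n : ℕ} (hn : 2 ≤ n) :
    0 ≤ (n : ℝ) / (n - 1) ∧ (n : ℝ) / (n - 1) ≤ 2 := by
  have h2 : (2 : ℝ) ≤ n := by exact_mod_cast hn
  refine ⟨div_nonneg (by linarith) (by linarith), ?_⟩
  rw [div_le_iff₀ (by linarith)]
  linarith

lemma sampleAbsDevFrom_nonneg (x : ℕ → ℝ) (n : ℕ) (t : ℝ) : 0 ≤ sampleAbsDevFrom x n t :=
  sampleMean_nonneg fun _ _ => abs_nonneg _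

lemma sampleVar_nonneg {x : ℕ → ℝ} {n : ℕ} (hn : 1 ≤ n) : 0 ≤ sampleVar x n := by
  have : (1 : ℝ) ≤ n := by exact_mod_cast hn
  exact div_nonneg (Finset.sum_nonneg fun _ _ => sq_nonneg _) (by linarith)

lemma jackVar_nonneg {x : ℕ → ℝ} {n : ℕ} (hn : 1 ≤ n) : 0 ≤ jackVar x n := by
  have : (1 : ℝ) ≤ n := by exact_mod_cast hn
  exact div_nonneg (Finset.sum_nonneg fun _ _ => sq_nonneg _) (by linarith)

lemma sampleGmd_nonneg {x : ℕ → ℝ} {n : ℕ} (hn : 2 ≤ n) : 0 ≤ sampleGmd x n := by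
  rw [sampleGmd_eq (by omega)]
  exact mul_nonneg (ratio_nonneg_le_two hn).1
    (sampleMean_nonneg fun _ _ => sampleAbsDevFrom_nonneg _ _ _)

lemma sampleTau_nonneg {x : ℕ → ℝ} (hx : ∀ i, 0 ≤ x i) {n : ℕ} (hn : 2 ≤ n) :
    0 ≤ sampleTau x n := by
  rw [sampleTau_eq (by omega)]
  exact mul_nonneg (ratio_nonneg_le_two hn).1
    (sampleMean_nonneg fun i _ => mul_nonneg (hx i) (sampleAbsDevFrom_nonneg _ _ _))

lemma sampleGmd_le {x : ℕ → ℝ} (hx : ∀ i, 0 ≤ x i) {n : ℕ} (hn : 2 ≤ n) :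
    sampleGmd x n ≤ 4 * sampleMean x n := by
  have hn0 : n ≠ 0 := by omega
  have hG (t : ℝ) (ht : 0 ≤ t) : sampleAbsDevFrom x n t ≤ t + sampleMean x n := by
    calc sampleAbsDevFrom x n t ≤ sampleMean (fun i => t + x i) n :=
          sampleMean_mono fun i _ => abs_sub_le_iff.2 ⟨by linarith [hx i], by linarith [hx i]⟩
      _ = t + sampleMean x n := by rw [sampleMean_add, sampleMean_const _ hn0]
  have hmean : sampleMean (fun i => sampleAbsDevFrom x n (x i)) n ≤ 2 * sampleMean x n := by
    calc _ ≤ sampleMean (fun i => x i + sampleMean x n) n := sampleMean_mono fun i _ => hG _ (hx i)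
      _ = 2 * sampleMean x n := by
        rw [sampleMean_add, sampleMean_const _ hn0]
        ring
  obtain ⟨h0, h2⟩ := ratio_nonneg_le_two hn
  rw [sampleGmd_eq hn0]
  have hm : 0 ≤ sampleMean x n := sampleMean_nonneg fun i _ => hx i
  calc _ ≤ 2 * (2 * sampleMean x n) :=
        mul_le_mul h2 hmean (sampleMean_nonneg fun _ _ => sampleAbsDevFrom_nonneg _ _ _) zero_le_two
    _ = 4 * sampleMean x n := by ring

/-- Since Gini's mean difference is at most a multiple of the mean, the powers of the sample mean
in the denominators of `V_n²` beyond the second cancel; the term with `sampleTau` is nonpositive. -/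
lemma sampleXiSq_le {x : ℕ → ℝ} (hx : ∀ i, 0 ≤ x i) {n : ℕ} (hn : 2 ≤ n) :
    sampleXiSq x n ≤
      16 + 4 * (sampleVar x n / sampleMean x n ^ 2) + jackVar x n / sampleMean x n ^ 2 := by
  have hm : 0 ≤ sampleMean x n := sampleMean_nonneg fun i _ => hx i
  have hS : 0 ≤ sampleVar x n := sampleVar_nonneg (by omega)
  have hJ : 0 ≤ jackVar x n := jackVar_nonneg (by omega)
  have hg : 0 ≤ sampleGmd x n := sampleGmd_nonneg hn
  have hτ : 0 ≤ sampleTau x n := sampleTau_nonneg hx hn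
  -- If the sample mean is zero, then all quotients are zero.
  rcases hm.eq_or_lt with h0 | hpos
  · simp [sampleXiSq, ← h0]
  have hg2 : sampleGmd x n ^ 2 ≤ 16 * sampleMean x n ^ 2 := by
    calc sampleGmd x n ^ 2 ≤ (4 * sampleMean x n) ^ 2 := by
          gcongr
          exact sampleGmd_le hx hn
      _ = 16 * sampleMean x n ^ 2 := by ring
  have h1 : sampleGmd x n ^ 2 * sampleVar x n / (4 * sampleMean x n ^ 4) ≤
      4 * (sampleVar x n / sampleMean x n ^ 2) := by
    calc _ ≤ 16 * sampleMean x n ^ 2 * sampleVar x n / (4 * sampleMean x n ^ 4) := by gcongr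
      _ = _ := by
        field_simp
        ring
  have h2 : 0 ≤ sampleGmd x n / sampleMean x n ^ 3 * sampleTau x n := by positivity
  have h3 : sampleGmd x n ^ 2 / sampleMean x n ^ 2 ≤ 16 := by
    rwa [div_le_iff₀ (by positivity)]
  have h4 : jackVar x n / (4 * sampleMean x n ^ 2) ≤ jackVar x n / sampleMean x n ^ 2 := by
    gcongr
    nlinarith [sq_nonneg (sampleMean x n)]
  rw [sampleXiSq]
  linarith

lemma sampleVar_le (x : ℕ → ℝ) {n : ℕ} (hn : 2 ≤ n) :
    sampleVar x n ≤ 2 * sampleMean (fun i => x i ^ 2) n := by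
  obtain ⟨h0, h2⟩ := ratio_nonneg_le_two hn
  rw [sampleVar_eq (by omega)]
  have := sq_sampleMean_le x n
  exact mul_le_mul h2 (by nlinarith [sq_nonneg (sampleMean x n)]) (by linarith) zero_le_two

lemma jackVar_le {x : ℕ → ℝ} (hx : ∀ i, 0 ≤ x i) {n : ℕ} (hn : 3 ≤ n) :
    jackVar x n ≤ 64 * sampleMean (fun i => x i ^ 2) n := by
  have hn0 : n ≠ 0 := by omega
  obtain ⟨h0, h2⟩ := ratio_nonneg_le_two (show 2 ≤ n by omega)
  have hG (t : ℝ) (ht : 0 ≤ t) :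
      sampleAbsDevFrom x n t ^ 2 ≤ t ^ 2 + sampleMean (fun i => x i ^ 2) n := by
    calc sampleAbsDevFrom x n t ^ 2 ≤ sampleMean (fun i => |t - x i| ^ 2) n := sq_sampleMean_le _ _
      _ ≤ sampleMean (fun i => t ^ 2 + x i ^ 2) n := sampleMean_mono fun i _ => by
        rw [sq_abs]
        nlinarith [mul_nonneg ht (hx i)]
      _ = _ := by rw [sampleMean_add, sampleMean_const _ hn0]
  have hmean : sampleMean (fun i => sampleAbsDevFrom x n (x i) ^ 2) n ≤
      2 * sampleMean (fun i => x i ^ 2) n := by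
    calc _ ≤ sampleMean (fun i => x i ^ 2 + sampleMean (fun i => x i ^ 2) n) n :=
          sampleMean_mono fun i _ => hG _ (hx i)
      _ = _ := by
        rw [sampleMean_add, sampleMean_const _ hn0]
        ring
  have hsq := sq_sampleMean_le (fun i => sampleAbsDevFrom x n (x i)) n
  rw [jackVar_eq hn]
  calc _ ≤ 4 * (2 : ℝ) ^ 3 * (2 * sampleMean (fun i => x i ^ 2) n) := by
        refine mul_le_mul (by gcongr) ?_ (by linarith) (by positivity)
        nlinarith [sq_nonneg (sampleMean (fun i => sampleAbsDevFrom x n (x i)) n)]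
    _ = _ := by ring

/-- Jensen's inequality for `t ↦ t⁻²`. -/
lemma inv_sq_sampleMean_le {x : ℕ → ℝ} (hx : ∀ i, 0 < x i) {n : ℕ} (hn : n ≠ 0) :
    (sampleMean x n ^ 2)⁻¹ ≤ sampleMean (fun i => (x i ^ 2)⁻¹) n := by
  have hn' : (n : ℝ) ≠ 0 := by exact_mod_cast hn
  have h := (convexOn_zpow (𝕜 := ℝ) (-2)).map_sum_le (t := Finset.range n)
    (w := fun _ => (n : ℝ)⁻¹) (p := x) (fun _ _ => by positivity) (by simp [hn'])
    (fun i _ => hx i)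
  simp only [smul_eq_mul, ← Finset.mul_sum] at h
  simp only [zpow_neg] at h
  simp only [sampleMean, div_eq_inv_mul]
  exact_mod_cast h

/-! ### Uniform convergence of the mean absolute deviation -/

/-- Two properties of `h t = E|t - Y|`, where `m = E Y`: it is `1`-Lipschitz, and beyond `R` it has
slope `1` up to the error `h R + m - R = 2 E(Y - R)⁺`. -/
structure IsMeanAbsDev (h : ℝ → ℝ) (m : ℝ) : Prop where
  lipschitz : ∀ s t, |h s - h t| ≤ |s - t|
  tail : ∀ R t, R ≤ t → |h t - h R - (t - R)| ≤ h R + m - R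

lemma abs_absDiff_tail_le {R t : ℝ} (y : ℝ) (h : R ≤ t) :
    |(|t - y| - |R - y| - (t - R))| ≤ |R - y| + y - R := by
  rw [abs_le]
  constructor <;> cases abs_cases (t - y) <;> cases abs_cases (R - y) <;> linarith

lemma integrable_abs_const_sub {F : Measure ℝ} [IsProbabilityMeasure F]
    (hF : Integrable (fun x : ℝ => x) F) (t : ℝ) : Integrable (fun y => |t - y|) F :=
  ((integrable_const t).sub hF).abs

lemma integrable_abs_const_sub_add_sub {F : Measure ℝ} [IsProbabilityMeasure F]
    (hF : Integrable (fun x : ℝ => x) F) (R : ℝ) : Integrable (fun y => |R - y| + y - R) F :=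
  ((integrable_abs_const_sub hF R).add hF).sub (integrable_const R)

lemma absDevFrom_add_mean_sub {F : Measure ℝ} [IsProbabilityMeasure F]
    (hF : Integrable (fun x : ℝ => x) F) (R : ℝ) :
    absDevFrom F R + mean F - R = ∫ y, (|R - y| + y - R) ∂F := by
  have hadd : Integrable (fun y => |R - y| + y) F := (integrable_abs_const_sub hF R).add hF
  rw [integral_sub hadd (integrable_const _), integral_add (integrable_abs_const_sub hF R) hF]
  simp [absDevFrom, mean]

lemma isMeanAbsDev_absDevFrom {F : Measure ℝ} [IsProbabilityMeasure F]
    (hF : Integrable (fun x : ℝ => x) F) : IsMeanAbsDev (absDevFrom F) (mean F) := by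
  have hint := integrable_abs_const_sub hF
  constructor
  · intro s t
    rw [absDevFrom, absDevFrom, ← integral_sub (hint s) (hint t)]
    refine abs_integral_le_integral_abs.trans ?_
    calc ∫ y, |(|s - y| - |t - y|)| ∂F ≤ ∫ _, |s - t| ∂F := by
          refine integral_mono ((hint s).sub (hint t)).abs (integrable_const _) fun y => ?_
          simpa using abs_abs_sub_abs_le (s - y) (t - y)
      _ = |s - t| := by simp
  · intro R t hRt
    have h1 : absDevFrom F t - absDevFrom F R - (t - R) =
        ∫ y, (|t - y| - |R - y| - (t - R)) ∂F := by
      have hsub : Integrable (fun y => |t - y| - |R - y|) F := (hint t).sub (hint R)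
      rw [integral_sub hsub (integrable_const _), integral_sub (hint t) (hint R)]
      simp [absDevFrom]
    rw [h1, absDevFrom_add_mean_sub hF]
    refine abs_integral_le_integral_abs.trans ?_
    exact integral_mono (((hint t).sub (hint R)).sub (integrable_const _)).abs
      (integrable_abs_const_sub_add_sub hF R) fun y => abs_absDiff_tail_le y hRt

lemma isMeanAbsDev_sampleAbsDevFrom (x : ℕ → ℝ) {n : ℕ} (hn : n ≠ 0) :
    IsMeanAbsDev (sampleAbsDevFrom x n) (sampleMean x n) := by
  constructor
  · intro s t
    rw [sampleAbsDevFrom, sampleAbsDevFrom, ← sampleMean_sub]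
    refine (abs_sampleMean_le _ _).trans ?_
    calc _ ≤ sampleMean (fun _ => |s - t|) n := sampleMean_mono fun i _ => by
          simpa using abs_abs_sub_abs_le (s - x i) (t - x i)
      _ = |s - t| := sampleMean_const _ hn
  · intro R t hRt
    have h1 : sampleAbsDevFrom x n t - sampleAbsDevFrom x n R - (t - R) =
        sampleMean (fun i => |t - x i| - |R - x i| - (t - R)) n := by
      rw [sampleMean_sub, sampleMean_sub, sampleMean_const _ hn]
      rfl
    have h2 : sampleAbsDevFrom x n R + sampleMean x n - R =
        sampleMean (fun i => |R - x i| + x i - R) n := by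
      rw [sampleMean_sub, sampleMean_add, sampleMean_const _ hn]
      rfl
    rw [h1, h2]
    exact (abs_sampleMean_le _ _).trans (sampleMean_mono fun i _ => abs_absDiff_tail_le _ hRt)

lemma tendsto_absDevFrom_add_mean_sub {F : Measure ℝ} [IsProbabilityMeasure F]
    (hF : Integrable (fun x : ℝ => x) F) :
    Tendsto (fun R : ℝ => absDevFrom F R + mean F - R) atTop (𝓝 0) := by
  simp only [absDevFrom_add_mean_sub hF]
  rw [← integral_zero ℝ ℝ (μ := F)]
  refine tendsto_integral_filter_of_dominated_convergence (fun y => 2 * |y|) ?_ ?_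
    (hF.abs.const_mul 2) ?_
  · exact Eventually.of_forall fun R =>
      (integrable_abs_const_sub_add_sub hF R).aestronglyMeasurable
  · filter_upwards [eventually_ge_atTop 0] with R hR
    refine Eventually.of_forall fun y => ?_
    rw [Real.norm_eq_abs, abs_le]
    constructor <;> cases abs_cases (R - y) <;> cases abs_cases y <;> linarith
  · refine Eventually.of_forall fun y => tendsto_const_nhds.congr' ?_
    filter_upwards [eventually_ge_atTop y] with R hR
    rw [abs_of_nonneg (by linarith)]
    ring

/-- Pointwise convergence of mean absolute deviations on rational grids, together with convergence
of the means, implies uniform convergence on `[0, ∞)`: a finite grid and the Lipschitz property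
cover a bounded interval, and the tail estimate covers its complement. -/
lemma eventually_abs_sub_le_of_isMeanAbsDev {H : ℕ → ℝ → ℝ} {h : ℝ → ℝ} {M : ℕ → ℝ} {m : ℝ}
    (hH : ∀ n ≠ 0, IsMeanAbsDev (H n) (M n)) (hh : IsMeanAbsDev h m)
    (hM : Tendsto M atTop (𝓝 m))
    (hgrid : ∀ k K : ℕ, Tendsto (fun n => H n (k / K)) atTop (𝓝 (h (k / K))))
    (htail : Tendsto (fun R => h R + m - R) atTop (𝓝 0)) {ε : ℝ} (hε : 0 < ε) :
    ∀ᶠ n in atTop, ∀ t, 0 ≤ t → |H n t - h t| ≤ ε := by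
  set δ := ε / 6 with hδ
  have hδ0 : 0 < δ := by positivity
  obtain ⟨K, hKtail, hKδ, hK0⟩ : ∃ K : ℕ, h K + m - K < δ ∧ 1 / (K : ℝ) < δ ∧ 0 < K := by
    have h1 := (htail.comp tendsto_natCast_atTop_atTop).eventually_lt_const hδ0
    have h2 := tendsto_one_div_atTop_nhds_zero_nat (𝕜 := ℝ) |>.eventually_lt_const hδ0
    exact (h1.and (h2.and (eventually_gt_atTop 0))).exists
  have hKpos : (0 : ℝ) < K := by exact_mod_cast hK0
  have hnear : ∀ᶠ n in atTop, ∀ k ∈ Finset.range (K * K + 1), |H n (k / K) - h (k / K)| < δ := by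
    rw [eventually_all_finset]
    intro k _
    have := (Metric.tendsto_nhds.1 (hgrid k K)) δ hδ0
    simpa only [Real.dist_eq] using this
  have hMnear : ∀ᶠ n in atTop, |M n - m| < δ := by
    simpa only [Real.dist_eq] using Metric.tendsto_nhds.1 hM δ hδ0
  filter_upwards [hnear, hMnear, eventually_ne_atTop 0] with n hn hMn hn0 t ht
  rcases le_total t K with htK | htK
  · set k := ⌊t * K⌋₊ with hk
    have hkle : (k : ℝ) ≤ t * K := Nat.floor_le (by positivity)
    have hklt : t * K < k + 1 := Nat.lt_floor_add_one _
    have hkK : k ∈ Finset.range (K * K + 1) := by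
      rw [Finset.mem_range, Nat.lt_succ_iff]
      have : (k : ℝ) ≤ K * K := hkle.trans (by gcongr)
      exact_mod_cast this
    have hdist : |t - k / K| ≤ δ := by
      have h1 : (k : ℝ) / K ≤ t := by rwa [div_le_iff₀ hKpos]
      have h2 : t ≤ (k : ℝ) / K + 1 / K := by
        rw [← add_div, le_div_iff₀ hKpos]
        exact hklt.le
      rw [abs_of_nonneg (by linarith)]
      linarith
    have e1 := abs_le.1 (((hH n hn0).lipschitz t (k / K)).trans hdist)
    have e2 := abs_lt.1 (hn k hkK)
    have e3 := abs_le.1 ((hh.lipschitz t (k / K)).trans hdist)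
    rw [abs_le]
    constructor <;> linarith
  · have hKK : ((K * K : ℕ) : ℝ) / K = K := by
      push_cast
      field_simp
    have e2 := hn (K * K) (Finset.self_mem_range_succ _)
    rw [hKK, abs_lt] at e2
    have e1 := abs_le.1 ((hH n hn0).tail K t htK)
    have e3 := abs_le.1 (hh.tail K t htK)
    have e4 := abs_lt.1 hMn
    rw [abs_le]
    constructor <;> linarith

/-! ### Consistency of the variance estimator along a fixed sequence -/

/-- Averages of `u n j` and of `v j` over `j < n` have the same limit if `|u n j - v j| ≤ ε c j`
eventually, for every `ε > 0`, with weights `c j` whose averages converge. -/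
lemma tendsto_sampleMean_of_abs_sub_le {u : ℕ → ℕ → ℝ} {v c : ℕ → ℝ} {L C : ℝ}
    (hv : Tendsto (sampleMean v) atTop (𝓝 L)) (hc : Tendsto (sampleMean c) atTop (𝓝 C))
    (h : ∀ ε > 0, ∀ᶠ n in atTop, ∀ j < n, |u n j - v j| ≤ ε * c j) :
    Tendsto (fun n => sampleMean (u n) n) atTop (𝓝 L) := by
  suffices hdiff : Tendsto (fun n => sampleMean (u n) n - sampleMean v n) atTop (𝓝 0) by
    simpa using hdiff.add hv
  rw [Metric.tendsto_nhds]
  intro η hη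
  have hC : 0 < |C| + 1 := by positivity
  have hlt : ∀ᶠ n in atTop, sampleMean c n < |C| + 1 :=
    hc.eventually_lt_const (by linarith [le_abs_self C])
  filter_upwards [h (η / (|C| + 1)) (by positivity), hlt] with n hn hcn
  rw [Real.dist_eq, sub_zero, ← sampleMean_sub]
  calc |sampleMean (fun i => u n i - v i) n|
      ≤ sampleMean (fun i => |u n i - v i|) n := abs_sampleMean_le _ _
    _ ≤ sampleMean (fun i => η / (|C| + 1) * c i) n := sampleMean_mono hn
    _ = η / (|C| + 1) * sampleMean c n := sampleMean_const_mul _ _ _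
    _ < η / (|C| + 1) * (|C| + 1) := by gcongr
    _ = η := by field_simp

lemma tendsto_natCast_div_sub_one :
    Tendsto (fun n : ℕ => (n : ℝ) / (n - 1)) atTop (𝓝 1) := by
  have h : Tendsto (fun n : ℕ => ((n + 1 : ℕ) : ℝ) / ((n + 1 : ℕ) - 1)) atTop (𝓝 1) := by
    have h1 : Tendsto (fun n : ℕ => 1 + 1 / (n : ℝ)) atTop (𝓝 1) := by
      simpa using tendsto_one_div_atTop_nhds_zero_nat.const_add (1 : ℝ)
    refine h1.congr' ?_
    filter_upwards [eventually_ne_atTop 0] with n hn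
    have : (n : ℝ) ≠ 0 := by exact_mod_cast hn
    push_cast
    rw [add_sub_cancel_right, add_div, div_self this]
  exact (tendsto_add_atTop_iff_nat 1).1 h

/-- If the averages along `x` of the functions `|t - ·|` (with `t` rational), `id`, the square, `g`,
`id * g` and `g²`, where `g = absDevFrom F`, converge to their integrals with respect to `F`, then
`V_n²` converges to `ξ²`. -/
lemma tendsto_sampleXiSq {F : Measure ℝ} [IsProbabilityMeasure F]
    (hF : Integrable (fun x : ℝ => x) F) {x : ℕ → ℝ} (hx : ∀ i, 0 ≤ x i) (hmean : mean F ≠ 0)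
    {q e : ℝ}
    (h1 : Tendsto (sampleMean x) atTop (𝓝 (mean F)))
    (h2 : Tendsto (sampleMean fun i => x i ^ 2) atTop (𝓝 q)) (hq : sigmaSq F = q - mean F ^ 2)
    (hgrid : ∀ k K : ℕ, Tendsto (sampleMean fun i => |(k : ℝ) / K - x i|) atTop
      (𝓝 (absDevFrom F (k / K))))
    (hg : Tendsto (sampleMean fun i => absDevFrom F (x i)) atTop (𝓝 (meanDiff F)))
    (hxg : Tendsto (sampleMean fun i => x i * absDevFrom F (x i)) atTop (𝓝 (tau F)))
    (hg2 : Tendsto (sampleMean fun i => absDevFrom F (x i) ^ 2) atTop (𝓝 e))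
    (he : sigmaOneSq F = e - meanDiff F ^ 2) :
    Tendsto (sampleXiSq x) atTop (𝓝 (xiSq F)) := by
  have hunif {ε : ℝ} (hε : 0 < ε) :
      ∀ᶠ n in atTop, ∀ t, 0 ≤ t → |sampleAbsDevFrom x n t - absDevFrom F t| ≤ ε :=
    eventually_abs_sub_le_of_isMeanAbsDev (fun n hn => isMeanAbsDev_sampleAbsDevFrom x hn)
      (isMeanAbsDev_absDevFrom hF) h1 hgrid (tendsto_absDevFrom_add_mean_sub hF) hε
  have hone : Tendsto (sampleMean fun _ => (1 : ℝ)) atTop (𝓝 1) :=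
    tendsto_const_nhds.congr' (by
      filter_upwards [eventually_ne_atTop 0] with n hn using (sampleMean_const 1 hn).symm)
  have lg : Tendsto (fun n => sampleMean (fun i => sampleAbsDevFrom x n (x i)) n) atTop
      (𝓝 (meanDiff F)) := by
    refine tendsto_sampleMean_of_abs_sub_le hg hone fun ε hε => ?_
    filter_upwards [hunif hε] with n hn j _
    simpa using hn _ (hx j)
  have lxg : Tendsto (fun n => sampleMean (fun i => x i * sampleAbsDevFrom x n (x i)) n) atTop
      (𝓝 (tau F)) := by
    refine tendsto_sampleMean_of_abs_sub_le hxg h1 fun ε hε => ?_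
    filter_upwards [hunif hε] with n hn j _
    rw [← mul_sub, abs_mul, abs_of_nonneg (hx j), mul_comm]
    exact mul_le_mul_of_nonneg_right (hn _ (hx j)) (hx j)
  have lg2 : Tendsto (fun n => sampleMean (fun i => sampleAbsDevFrom x n (x i) ^ 2) n) atTop
      (𝓝 e) := by
    have hc : Tendsto (sampleMean fun i => 2 * absDevFrom F (x i) + 1) atTop
        (𝓝 (2 * meanDiff F + 1)) := by
      refine ((hg.const_mul 2).add hone).congr fun n => ?_
      rw [sampleMean_add, sampleMean_const_mul]
    refine tendsto_sampleMean_of_abs_sub_le hg2 hc fun ε hε => ?_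
    filter_upwards [hunif hε, hunif one_pos] with n hn hn1 j _
    have h0 : 0 ≤ absDevFrom F (x j) := integral_nonneg fun _ => abs_nonneg _
    have h0' := sampleAbsDevFrom_nonneg x n (x j)
    have hle := (abs_le.1 (hn1 _ (hx j))).2
    rw [sq_sub_sq, abs_mul, mul_comm, abs_of_nonneg (add_nonneg h0' h0)]
    exact mul_le_mul (hn _ (hx j)) (by linarith) (by positivity) hε.le
  have hr := tendsto_natCast_div_sub_one
  have lG : Tendsto (sampleGmd x) atTop (𝓝 (meanDiff F)) := by
    have := hr.mul lg
    rw [one_mul] at this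
    refine this.congr' ?_
    filter_upwards [eventually_ne_atTop 0] with n hn using (sampleGmd_eq hn).symm
  have lT : Tendsto (sampleTau x) atTop (𝓝 (tau F)) := by
    have := hr.mul lxg
    rw [one_mul] at this
    refine this.congr' ?_
    filter_upwards [eventually_ne_atTop 0] with n hn using (sampleTau_eq hn).symm
  have lS : Tendsto (sampleVar x) atTop (𝓝 (sigmaSq F)) := by
    have := hr.mul (h2.sub (h1.pow 2))
    rw [one_mul, ← hq] at this
    refine this.congr' ?_
    filter_upwards [eventually_ne_atTop 0] with n hn using (sampleVar_eq hn).symm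
  have lJ : Tendsto (jackVar x) atTop (𝓝 (4 * sigmaOneSq F)) := by
    have := ((hr.pow 3).const_mul 4).mul (lg2.sub (lg.pow 2))
    rw [one_pow, mul_one, ← he] at this
    refine this.congr' ?_
    filter_upwards [eventually_ge_atTop 3] with n hn using (jackVar_eq hn).symm
  have t1 := ((lG.pow 2).mul lS).div ((h1.pow 4).const_mul 4) (by positivity)
  have t2 := (lG.div (h1.pow 3) (by positivity)).mul lT
  have t3 := (lG.pow 2).div (h1.pow 2) (by positivity)
  have t4 := lJ.div ((h1.pow 2).const_mul 4) (by positivity)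
  have hlim : xiSq F = meanDiff F ^ 2 * sigmaSq F / (4 * mean F ^ 4)
      - meanDiff F / mean F ^ 3 * tau F + meanDiff F ^ 2 / mean F ^ 2
      + 4 * sigmaOneSq F / (4 * mean F ^ 2) := by
    rw [xiSq]
    field_simp
  rw [hlim]
  exact ((t1.sub t2).add t3).add t4

variable {Ω : Type*} [MeasurableSpace Ω] {P : Measure Ω}

/-! ### Measurability of the stopping time -/

lemma measurable_sampleMean {X : ℕ → Ω → ℝ} (hX : ∀ i, Measurable (X i)) (n : ℕ) :
    Measurable fun ω => sampleMean (fun i => X i ω) n := by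
  unfold sampleMean
  fun_prop

lemma measurable_gmdOn {X : ℕ → Ω → ℝ} (hX : ∀ i, Measurable (X i)) (s : Finset ℕ) :
    Measurable fun ω => gmdOn (fun i => X i ω) s := by
  unfold gmdOn
  fun_prop

lemma measurable_sampleVar {X : ℕ → Ω → ℝ} (hX : ∀ i, Measurable (X i)) (n : ℕ) :
    Measurable fun ω => sampleVar (fun i => X i ω) n := by
  have := measurable_sampleMean hX n
  unfold sampleVar
  fun_prop

lemma measurable_jackVar {X : ℕ → Ω → ℝ} (hX : ∀ i, Measurable (X i)) (n : ℕ) :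
    Measurable fun ω => jackVar (fun i => X i ω) n := by
  have h := measurable_gmdOn hX
  have hW (j : ℕ) : Measurable fun ω => jackW (fun i => X i ω) n j := by
    unfold jackW sampleGmd sampleGmdLeaveOut
    fun_prop
  have hWm : Measurable fun ω => jackWMean (fun i => X i ω) n := by
    unfold jackWMean
    fun_prop
  unfold jackVar
  fun_prop

lemma measurable_sampleXiSq {X : ℕ → Ω → ℝ} (hX : ∀ i, Measurable (X i)) (n : ℕ) :
    Measurable fun ω => sampleXiSq (fun i => X i ω) n := by
  have h1 := measurable_sampleMean hX n
  have h2 := measurable_sampleVar hX n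
  have h3 := measurable_jackVar hX n
  have h4 := measurable_gmdOn hX
  have h5 : Measurable fun ω => sampleTau (fun i => X i ω) n := by
    unfold sampleTau
    fun_prop
  unfold sampleXiSq sampleGmd
  fun_prop

lemma measurable_stopTime {X : ℕ → Ω → ℝ} (hX : ∀ i, Measurable (X i)) (z d : ℝ) :
    Measurable fun ω => stopTime z d (fun i => X i ω) := by
  have hS (n : ℕ) : MeasurableSet {ω | Stops z d (fun i => X i ω) n} := by
    simp only [Stops, Set.ofPred_and]
    refine (MeasurableSet.const _).inter (measurableSet_le ?_ measurable_const)
    exact ((measurable_sampleXiSq hX n).add_const _).const_mul _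
  refine ENat.measurable_iff.2 fun n => ?_
  have : (fun ω => stopTime z d (fun i => X i ω)) ⁻¹' {(n : ℕ∞)} =
      {ω | Stops z d (fun i => X i ω) n} ∩ ⋂ k < n, {ω | Stops z d (fun i => X i ω) k}ᶜ := by
    ext ω
    simp [stopTime_eq_coe_iff]
  rw [this]
  exact (hS n).inter (MeasurableSet.biInter (Set.to_countable _) fun k _ => (hS k).compl)

/-! ### A maximal inequality for averages of independent variables -/

/-- The variances of the averages over the first `2 ^ k` variables form a summable sequence. For
nonnegative variables, the average over `n` variables is at most twice the average over `2 ^ k`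
variables if `n ≤ 2 ^ k ≤ 2 n`, so controlling these averages suffices. -/
lemma lintegral_iSup_sq_sampleMean_lt_top [IsProbabilityMeasure P] {Y : ℕ → Ω → ℝ}
    (hY : ∀ i, Measurable (Y i)) (hnonneg : ∀ i ω, 0 ≤ Y i ω) (hindep : iIndepFun Y P)
    (hident : ∀ i, IdentDistrib (Y i) (Y 0) P P) (hL2 : MemLp (Y 0) 2 P) :
    ∫⁻ ω, ⨆ n : ℕ, ENNReal.ofReal (sampleMean (fun i => Y i ω) n ^ 2) ∂P < ∞ := by
  have hmem (i : ℕ) : MemLp (Y i) 2 P := (hident i).symm.memLp_snd hL2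
  set c := ∫ ω, Y 0 ω ∂P with hc
  set M : ℕ → Ω → ℝ := fun k ω => sampleMean (fun i => Y i ω) (2 ^ k) with hM
  have hMeq (k : ℕ) : M k = fun ω => ((2 : ℝ) ^ k)⁻¹ * (∑ i ∈ Finset.range (2 ^ k), Y i) ω := by
    ext ω
    simp [hM, sampleMean, div_eq_inv_mul]
  have hMmem (k : ℕ) : MemLp (M k) 2 P := by
    rw [hMeq]
    exact (memLp_finsetSum' _ fun i _ => hmem i).const_mul _
  have hMmean (k : ℕ) : ∫ ω, M k ω ∂P = c := by
    rw [hMeq, integral_const_mul]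
    simp only [Finset.sum_apply]
    rw [integral_finsetSum _ fun i _ => (hmem i).integrable one_le_two]
    simp [fun i => (hident i).integral_eq, ← hc]
  have hMvar (k : ℕ) : variance (M k) P = variance (Y 0) P * (1 / 2) ^ k := by
    rw [hMeq, variance_const_mul, IndepFun.variance_sum (fun i _ => hmem i)
      (fun i _ j _ hij => hindep.indepFun hij)]
    simp only [fun i => (hident i).variance_eq, Finset.sum_const, Finset.card_range, nsmul_eq_mul]
    push_cast
    rw [one_div, inv_pow (2 : ℝ) k]
    field_simp
  have hpath (ω : Ω) : ⨆ n : ℕ, ENNReal.ofReal (sampleMean (fun i => Y i ω) n ^ 2) ≤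
      ENNReal.ofReal (8 * c ^ 2) + ∑' k, ENNReal.ofReal (8 * (M k ω - c) ^ 2) := by
    refine iSup_le fun n => ?_
    rcases eq_or_ne n 0 with rfl | hn
    · simp [sampleMean]
    -- The smallest power of two exceeding `n` is at most `2 n`.
    set k := Nat.log 2 n + 1 with hk
    have hnk : n ≤ 2 ^ k := (Nat.lt_pow_succ_log_self one_lt_two n).le
    have hkn : 2 ^ k ≤ 2 * n := by
      rw [hk, pow_succ, mul_comm]
      exact Nat.mul_le_mul_left 2 (Nat.pow_log_le_self 2 hn)
    have hle : sampleMean (fun i => Y i ω) n ≤ 2 * M k ω := by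
      have hn0 : (0 : ℝ) < n := by exact_mod_cast Nat.pos_of_ne_zero hn
      have hsum : ∑ i ∈ Finset.range n, Y i ω ≤ ∑ i ∈ Finset.range (2 ^ k), Y i ω :=
        Finset.sum_le_sum_of_subset_of_nonneg (Finset.range_mono hnk) fun i _ _ => hnonneg i ω
      have hkn' : ((2 ^ k : ℕ) : ℝ) ≤ 2 * n := by exact_mod_cast hkn
      have h0 : 0 ≤ ∑ i ∈ Finset.range (2 ^ k), Y i ω :=
        Finset.sum_nonneg fun i _ => hnonneg i ω
      simp only [hM, sampleMean]
      rw [div_le_iff₀ hn0]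
      calc _ ≤ ∑ i ∈ Finset.range (2 ^ k), Y i ω := hsum
        _ = (∑ i ∈ Finset.range (2 ^ k), Y i ω) / (2 ^ k : ℕ) * (2 ^ k : ℕ) := by field_simp
        _ ≤ (∑ i ∈ Finset.range (2 ^ k), Y i ω) / (2 ^ k : ℕ) * (2 * n) := by gcongr
        _ = _ := by ring
    have h0 : 0 ≤ sampleMean (fun i => Y i ω) n := sampleMean_nonneg fun i _ => hnonneg i ω
    calc ENNReal.ofReal (sampleMean (fun i => Y i ω) n ^ 2)
        ≤ ENNReal.ofReal (8 * c ^ 2 + 8 * (M k ω - c) ^ 2) := by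
          apply ENNReal.ofReal_le_ofReal
          -- `(2 M)² ≤ 8 c² + 8 (M - c)²`
          nlinarith [pow_le_pow_left₀ h0 hle 2, sq_nonneg (M k ω - 2 * c)]
      _ = ENNReal.ofReal (8 * c ^ 2) + ENNReal.ofReal (8 * (M k ω - c) ^ 2) :=
          ENNReal.ofReal_add (by positivity) (by positivity)
      _ ≤ _ := by
          gcongr
          exact ENNReal.le_tsum k
  have hMmeas (k : ℕ) : Measurable (M k) := measurable_sampleMean hY _
  have hterm (k : ℕ) : ∫⁻ ω, ENNReal.ofReal (8 * (M k ω - c) ^ 2) ∂P =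
      ENNReal.ofReal (8 * (variance (Y 0) P * (1 / 2) ^ k)) := by
    simp only [ENNReal.ofReal_mul (show (0 : ℝ) ≤ 8 by norm_num)]
    rw [lintegral_const_mul _ (by fun_prop), ← ENNReal.ofReal_mul (by norm_num),
      ← hMvar, ENNReal.ofReal_mul (by norm_num), (hMmem k).ofReal_variance_eq,
      evariance_eq_lintegral_ofReal, hMmean]
  calc ∫⁻ ω, ⨆ n : ℕ, ENNReal.ofReal (sampleMean (fun i => Y i ω) n ^ 2) ∂P
      ≤ ∫⁻ ω, ENNReal.ofReal (8 * c ^ 2) + ∑' k, ENNReal.ofReal (8 * (M k ω - c) ^ 2) ∂P :=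
        lintegral_mono hpath
    _ = ENNReal.ofReal (8 * c ^ 2) +
          ∑' k, ENNReal.ofReal (8 * (variance (Y 0) P * (1 / 2) ^ k)) := by
        rw [lintegral_add_left measurable_const, lintegral_tsum fun k => by fun_prop]
        simp only [hterm, lintegral_const, measure_univ, mul_one]
    _ < ∞ := by
        refine ENNReal.add_lt_top.2 ⟨ENNReal.ofReal_lt_top, ?_⟩
        have hs : Summable fun k : ℕ => 8 * (variance (Y 0) P * (1 / 2) ^ k) :=
          ((summable_geometric_of_lt_one (by norm_num) (by norm_num)).mul_left _).mul_left _
        exact hs.tsum_ofReal_lt_top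

/-! ### Moments of the population quantities -/

lemma ae_pos_of_lintegral_rpow_neg {F : Measure ℝ} {β : ℝ} (hβ : 0 < β)
    (h : ∫⁻ x, ENNReal.ofReal x ^ (-β) ∂F < ∞) : ∀ᵐ x ∂F, 0 < x := by
  have hmeas : Measurable fun x : ℝ => ENNReal.ofReal x ^ (-β) := by fun_prop
  filter_upwards [ae_lt_top hmeas h.ne] with x hx
  by_contra! hx0
  rw [ENNReal.ofReal_of_nonpos hx0, ENNReal.zero_rpow_of_neg (by linarith)] at hx
  exact lt_irrefl _ hx

section Moments

variable {F : Measure ℝ} [IsProbabilityMeasure F]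

lemma memLp_two_of_integrable_pow_four (hfour : Integrable (fun x : ℝ => x ^ 4) F) :
    MemLp (fun x : ℝ => x) 2 F := by
  refine (memLp_two_iff_integrable_sq measurable_id.aestronglyMeasurable).2 ?_
  refine (hfour.add (integrable_const 1)).mono' (by fun_prop) (Eventually.of_forall fun x => ?_)
  simp only [Pi.add_apply, id, norm_pow, Real.norm_eq_abs, sq_abs]
  nlinarith [sq_nonneg (x ^ 2 - 1), sq_nonneg x]

lemma continuous_absDevFrom (hF : Integrable (fun x : ℝ => x) F) : Continuous (absDevFrom F) := by
  refine (LipschitzWith.of_dist_le_mul (K := 1) fun s t => ?_).continuous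
  simpa [Real.dist_eq] using (isMeanAbsDev_absDevFrom hF).lipschitz s t

lemma memLp_two_absDevFrom (hF : MemLp (fun x : ℝ => x) 2 F) : MemLp (absDevFrom F) 2 F := by
  have hint := hF.integrable one_le_two
  have hcont := continuous_absDevFrom hint
  refine MemLp.of_le (g := fun x => |x| + absDevFrom F 0) (hF.abs.add (memLp_const _))
    hcont.aestronglyMeasurable (Eventually.of_forall fun x => ?_)
  have h0 (t : ℝ) : 0 ≤ absDevFrom F t := integral_nonneg fun _ => abs_nonneg _
  have h := (abs_le.1 ((isMeanAbsDev_absDevFrom hint).lipschitz x 0)).2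
  rw [sub_zero] at h
  rw [Real.norm_of_nonneg (h0 x), Real.norm_of_nonneg (add_nonneg (abs_nonneg x) (h0 0))]
  linarith

lemma meanDiff_eq_integral (hF : Integrable (fun x : ℝ => x) F) :
    meanDiff F = ∫ x, absDevFrom F x ∂F :=
  integral_prod _ ((hF.comp_fst F).sub (hF.comp_snd F)).abs

lemma tau_eq_integral (hF : MemLp (fun x : ℝ => x) 2 F) :
    tau F = ∫ x, x * absDevFrom F x ∂F := by
  have hint := hF.integrable one_le_two
  have hsq : Integrable (fun p : ℝ × ℝ => p.1 ^ 2) (F.prod F) := hF.integrable_sq.comp_fst F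
  have hmul : Integrable (fun p : ℝ × ℝ => |p.1| * |p.2|) (F.prod F) := hint.abs.mul_prod hint.abs
  have : Integrable (fun p : ℝ × ℝ => p.1 * |p.1 - p.2|) (F.prod F) := by
    refine (hsq.add hmul).mono' (by fun_prop) (Eventually.of_forall fun p => ?_)
    rw [Real.norm_eq_abs, abs_mul, abs_abs, Pi.add_apply, ← sq_abs, pow_two, ← mul_add]
    gcongr
    exact abs_sub _ _
  rw [tau, integral_prod _ this]
  simp only [integral_const_mul, absDevFrom]

/-- A moment of order less than `-4` yields the moment of order `-4`. -/
lemma integrable_inv_sq_sq {β : ℝ} (hβ : 4 < β) (hnonneg : ∀ᵐ x ∂F, 0 ≤ x)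
    (h : ∫⁻ x, ENNReal.ofReal x ^ (-β) ∂F < ∞) :
    Integrable (fun x : ℝ => ((x ^ 2)⁻¹) ^ 2) F := by
  refine ⟨by fun_prop, ?_⟩
  rw [hasFiniteIntegral_iff_ofReal (Eventually.of_forall fun x => by positivity)]
  calc ∫⁻ x, ENNReal.ofReal (((x ^ 2)⁻¹) ^ 2) ∂F
      ≤ ∫⁻ x, 1 + ENNReal.ofReal x ^ (-β) ∂F := by
        refine lintegral_mono_ae (hnonneg.mono fun x hx => ?_)
        rcases hx.eq_or_lt with rfl | hpos
        · simp
        have hx4 : ((x ^ 2)⁻¹) ^ 2 = x ^ (-4 : ℝ) := by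
          rw [Real.rpow_neg hx, inv_pow, ← pow_mul]
          norm_cast
        rw [hx4, ENNReal.ofReal_rpow_of_pos hpos]
        rcases le_total 1 x with h1 | h1
        · refine le_add_right ?_
          rw [← ENNReal.ofReal_one]
          exact ENNReal.ofReal_le_ofReal (Real.rpow_le_one_of_one_le_of_nonpos h1 (by norm_num))
        · refine le_add_left (ENNReal.ofReal_le_ofReal ?_)
          exact Real.rpow_le_rpow_of_exponent_ge hpos h1 (by linarith)
    _ < ∞ := by
        rw [lintegral_add_left measurable_const]
        simpa using h

end Moments

/-! ### Strong laws and the supremum of the variance estimator -/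

section Sample

variable {F : Measure ℝ} {X : ℕ → Ω → ℝ}

lemma ae_tendsto_sampleMean_comp (hX : ∀ i, Measurable (X i)) (hindep : iIndepFun X P)
    (hlaw : ∀ i, HasLaw (X i) F P) {φ : ℝ → ℝ} (hφ : Measurable φ) (hint : Integrable φ F) :
    ∀ᵐ ω ∂P, Tendsto (sampleMean fun i => φ (X i ω)) atTop (𝓝 (∫ x, φ x ∂F)) := by
  have hid (i : ℕ) : IdentDistrib (φ ∘ X i) (φ ∘ X 0) P P :=
    (IdentDistrib.mk (hX i).aemeasurable (hX 0).aemeasurable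
      ((hlaw i).map_eq.trans (hlaw 0).map_eq.symm)).comp hφ
  have hint0 : Integrable (φ ∘ X 0) P := by
    rw [← integrable_map_measure (by rw [(hlaw 0).map_eq]; exact hφ.aestronglyMeasurable)
      (hX 0).aemeasurable, (hlaw 0).map_eq]
    exact hint
  have h := strong_law_ae_real (fun i => φ ∘ X i) hint0
    (fun i j hij => (hindep.indepFun hij).comp hφ hφ) hid
  rw [(hlaw 0).integral_comp hφ.aestronglyMeasurable] at h
  exact h

lemma ae_forall_of_hasLaw (hlaw : ∀ i, HasLaw (X i) F P) {p : ℝ → Prop} (hp : ∀ᵐ x ∂F, p x) :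
    ∀ᵐ ω ∂P, ∀ i, p (X i ω) := by
  refine ae_all_iff.2 fun i => ?_
  rw [← (hlaw i).map_eq] at hp
  exact ae_of_ae_map (hlaw i).aemeasurable hp

lemma ae_tendsto_sampleXiSq [IsProbabilityMeasure F] (hX : ∀ i, Measurable (X i))
    (hindep : iIndepFun X P)
    (hlaw : ∀ i, HasLaw (X i) F P) (hnonneg : ∀ᵐ x ∂F, 0 ≤ x)
    (hF : MemLp (fun x : ℝ => x) 2 F) (hmean : mean F ≠ 0) :
    ∀ᵐ ω ∂P, Tendsto (sampleXiSq fun i => X i ω) atTop (𝓝 (xiSq F)) := by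
  have hint := hF.integrable one_le_two
  have hg := memLp_two_absDevFrom hF
  have hgm : Measurable (absDevFrom F) := (continuous_absDevFrom hint).measurable
  have slln {φ : ℝ → ℝ} (hφ : Measurable φ) (hφi : Integrable φ F) :=
    ae_tendsto_sampleMean_comp hX hindep hlaw hφ hφi
  have hgrid : ∀ᵐ ω ∂P, ∀ k K : ℕ, Tendsto (sampleMean fun i => |(k : ℝ) / K - X i ω|) atTop
      (𝓝 (absDevFrom F (k / K))) :=
    ae_all_iff.2 fun k => ae_all_iff.2 fun K =>
      slln (φ := fun x => |(k : ℝ) / K - x|) (by fun_prop) (integrable_abs_const_sub hint _)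
  have hvar {f : ℝ → ℝ} (hf : MemLp f 2 F) :
      variance f F = (∫ x, f x ^ 2 ∂F) - (∫ x, f x ∂F) ^ 2 := by
    rw [variance_eq_sub hf]
    rfl
  filter_upwards [ae_forall_of_hasLaw hlaw hnonneg, slln measurable_id hint,
    slln (φ := fun x => x ^ 2) (by fun_prop) hF.integrable_sq, hgrid,
    slln hgm (hg.integrable one_le_two),
    slln (φ := fun x => x * absDevFrom F x) (by fun_prop) (hF.integrable_mul hg),
    slln (φ := fun x => absDevFrom F x ^ 2) (by fun_prop) hg.integrable_sq]
    with ω h0 h1 h2 h3 h4 h5 h6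
  rw [← meanDiff_eq_integral hint] at h4
  rw [← tau_eq_integral hF] at h5
  refine tendsto_sampleXiSq hint h0 hmean h1 h2 (hvar hF) h3 h4 h5 h6 ?_
  rw [sigmaOneSq, hvar hg, ← meanDiff_eq_integral hint]

/-- With the moments of order `4` and `-4`, the suprema of `s_{wn}² / X̄²` and of `S_n² / X̄²` are
integrable: the numerators are at most multiples of the average of the `X i ²`, the factor `X̄⁻²` is
at most the average of the `X i ⁻²`, and both averages have square integrable suprema. -/
lemma lintegral_iSup_lt_top_of_moments [IsProbabilityMeasure P]
    (hX : ∀ i, Measurable (X i)) (hindep : iIndepFun X P) (hlaw : ∀ i, HasLaw (X i) F P)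
    (hpos : ∀ᵐ x ∂F, 0 < x) (hfour : Integrable (fun x : ℝ => x ^ 4) F)
    (hinv : Integrable (fun x : ℝ => ((x ^ 2)⁻¹) ^ 2) F) {T : (ℕ → ℝ) → ℕ → ℝ} {c : ℝ}
    (hc : 0 ≤ c) {m : ℕ} (hm : m ≠ 0)
    (hT : ∀ x : ℕ → ℝ, (∀ i, 0 ≤ x i) → ∀ n ≥ m, T x n ≤ c * sampleMean (fun i => x i ^ 2) n) :
    ∫⁻ ω, (⨆ (n : ℕ) (_ : m ≤ n), ENNReal.ofReal
      (T (fun i => X i ω) n / sampleMean (fun i => X i ω) n ^ 2)) ∂P < ∞ := by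
  have hmax {φ : ℝ → ℝ} (hφ : Measurable φ) (hφ0 : ∀ x, 0 ≤ φ x)
      (hφ2 : Integrable (fun x => φ x ^ 2) F) :
      ∫⁻ ω, ⨆ n : ℕ, ENNReal.ofReal (sampleMean (fun i => φ (X i ω)) n ^ 2) ∂P < ∞ := by
    refine lintegral_iSup_sq_sampleMean_lt_top (Y := fun i => φ ∘ X i) (fun i => hφ.comp (hX i))
      (fun i ω => hφ0 _) (hindep.comp (fun _ => φ) fun _ => hφ) (fun i => ?_) ?_
    · exact (IdentDistrib.mk (hX i).aemeasurable (hX 0).aemeasurable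
        ((hlaw i).map_eq.trans (hlaw 0).map_eq.symm)).comp hφ
    · refine MemLp.comp_of_map ?_ (hX 0).aemeasurable
      rw [(hlaw 0).map_eq]
      exact (memLp_two_iff_integrable_sq hφ.aestronglyMeasurable).2 hφ2
  have hA := hmax (φ := fun x => x ^ 2) (by fun_prop) (fun x => by positivity)
    (by simpa only [← pow_mul] using hfour)
  have hB := hmax (φ := fun x => (x ^ 2)⁻¹) (by fun_prop) (fun x => by positivity) hinv
  have hmeas {φ : ℝ → ℝ} (hφ : Measurable φ) :
      Measurable fun ω => ⨆ n : ℕ, ENNReal.ofReal (sampleMean (fun i => φ (X i ω)) n ^ 2) :=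
    Measurable.iSup fun n =>
      ((measurable_sampleMean (fun i => hφ.comp (hX i)) n).pow_const 2).ennreal_ofReal
  calc _ ≤ ∫⁻ ω, ENNReal.ofReal c *
        ((⨆ n : ℕ, ENNReal.ofReal (sampleMean (fun i => X i ω ^ 2) n ^ 2)) +
          ⨆ n : ℕ, ENNReal.ofReal (sampleMean (fun i => (X i ω ^ 2)⁻¹) n ^ 2)) ∂P := by
        refine lintegral_mono_ae ((ae_forall_of_hasLaw hlaw hpos).mono fun ω hω => ?_)
        refine iSup₂_le fun n hn => ?_
        set a := sampleMean (fun i => X i ω ^ 2) n with ha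
        set b := sampleMean (fun i => (X i ω ^ 2)⁻¹) n with hb
        have ha0 : 0 ≤ a := sampleMean_nonneg fun i _ => by positivity
        have hle : T (fun i => X i ω) n / sampleMean (fun i => X i ω) n ^ 2 ≤
            c * (a ^ 2 + b ^ 2) := by
          rw [div_eq_mul_inv]
          calc _ ≤ c * a * (sampleMean (fun i => X i ω) n ^ 2)⁻¹ := by
                gcongr
                exact hT _ (fun i => (hω i).le) n hn
            _ ≤ c * a * b := by
                gcongr
                exact inv_sq_sampleMean_le hω (by omega)
            _ ≤ c * (a ^ 2 + b ^ 2) := by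
                rw [mul_assoc]
                gcongr
                nlinarith [sq_nonneg (a - b), sq_nonneg a, sq_nonneg b]
        calc _ ≤ ENNReal.ofReal (c * (a ^ 2 + b ^ 2)) := ENNReal.ofReal_le_ofReal hle
          _ = ENNReal.ofReal c * (ENNReal.ofReal (a ^ 2) + ENNReal.ofReal (b ^ 2)) := by
              rw [ENNReal.ofReal_mul hc, ENNReal.ofReal_add (by positivity) (by positivity)]
          _ ≤ _ := by
              gcongr
              · exact le_iSup (fun n : ℕ =>
                  ENNReal.ofReal (sampleMean (fun i => X i ω ^ 2) n ^ 2)) n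
              · exact le_iSup (fun n : ℕ =>
                  ENNReal.ofReal (sampleMean (fun i => (X i ω ^ 2)⁻¹) n ^ 2)) n
    _ < ∞ := by
        have m1 := hmeas (φ := fun x => x ^ 2) (by fun_prop)
        have m2 := hmeas (φ := fun x => (x ^ 2)⁻¹) (by fun_prop)
        rw [lintegral_const_mul' _ _ ENNReal.ofReal_ne_top, lintegral_add_left m1]
        exact ENNReal.mul_lt_top ENNReal.ofReal_lt_top (ENNReal.add_lt_top.2 ⟨hA, hB⟩)

lemma lintegral_iSup_sampleXiSq_lt_top [IsProbabilityMeasure P] (hX : ∀ i, Measurable (X i))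
    (hlaw : ∀ i, HasLaw (X i) F P) (hnonneg : ∀ᵐ x ∂F, 0 ≤ x) {m : ℕ} (hm : 2 ≤ m)
    (hJ : ∫⁻ ω, (⨆ (n : ℕ) (_ : m ≤ n), ENNReal.ofReal
      (jackVar (fun i => X i ω) n / sampleMean (fun i => X i ω) n ^ 2)) ∂P < ∞)
    (hS : ∫⁻ ω, (⨆ (n : ℕ) (_ : m ≤ n), ENNReal.ofReal
      (sampleVar (fun i => X i ω) n / sampleMean (fun i => X i ω) n ^ 2)) ∂P < ∞) :
    ∫⁻ ω, (⨆ (n : ℕ) (_ : m ≤ n), ENNReal.ofReal (sampleXiSq (fun i => X i ω) n)) ∂P < ∞ := by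
  have hmeas {T : (ℕ → ℝ) → ℕ → ℝ} (hT : ∀ n, Measurable fun ω => T (fun i => X i ω) n) :
      Measurable fun ω => ⨆ (n : ℕ) (_ : m ≤ n), ENNReal.ofReal
        (T (fun i => X i ω) n / sampleMean (fun i => X i ω) n ^ 2) :=
    Measurable.iSup fun n => Measurable.iSup fun _ =>
      ((hT n).div ((measurable_sampleMean hX n).pow_const 2)).ennreal_ofReal
  have mS := hmeas (measurable_sampleVar hX)
  calc _ ≤ ∫⁻ ω, (16 + 4 * ⨆ (n : ℕ) (_ : m ≤ n), ENNReal.ofReal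
          (sampleVar (fun i => X i ω) n / sampleMean (fun i => X i ω) n ^ 2)) +
        ⨆ (n : ℕ) (_ : m ≤ n), ENNReal.ofReal
          (jackVar (fun i => X i ω) n / sampleMean (fun i => X i ω) n ^ 2) ∂P := by
        refine lintegral_mono_ae ((ae_forall_of_hasLaw hlaw hnonneg).mono fun ω hω => ?_)
        refine iSup₂_le fun n hn => ?_
        have hS0 := sampleVar_nonneg (x := fun i => X i ω) (n := n) (by omega)
        have hJ0 := jackVar_nonneg (x := fun i => X i ω) (n := n) (by omega)
        refine (ENNReal.ofReal_le_ofReal (sampleXiSq_le hω (hm.trans hn))).trans ?_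
        rw [ENNReal.ofReal_add (by positivity) (by positivity),
          ENNReal.ofReal_add (by norm_num) (by positivity), ENNReal.ofReal_mul (by norm_num)]
        gcongr
        · simp
        · simp
        · exact le_iSup₂ (f := fun (n : ℕ) (_ : m ≤ n) => ENNReal.ofReal
            (sampleVar (fun i => X i ω) n / sampleMean (fun i => X i ω) n ^ 2)) n hn
        · exact le_iSup₂ (f := fun (n : ℕ) (_ : m ≤ n) => ENNReal.ofReal
            (jackVar (fun i => X i ω) n / sampleMean (fun i => X i ω) n ^ 2)) n hn
    _ < ∞ := by
        rw [lintegral_add_left (by fun_prop), lintegral_add_left measurable_const,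
          lintegral_const_mul _ mS]
        simp only [lintegral_const, measure_univ, mul_one]
        exact ENNReal.add_lt_top.2 ⟨ENNReal.add_lt_top.2 ⟨by simp,
          ENNReal.mul_lt_top (by simp) hS⟩, hJ⟩

end Sample

end GiniSeq

theorem theorem1
    {Ω : Type*} [MeasurableSpace Ω] (P : Measure Ω) [IsProbabilityMeasure P]
    (F : Measure ℝ) [IsProbabilityMeasure F]
    (X : ℕ → Ω → ℝ) (hX : ∀ i, Measurable (X i))
    (hindep : iIndepFun X P) (hlaw : ∀ i, HasLaw (X i) F P)
    (hnonneg : ∀ᵐ x ∂F, 0 ≤ x)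
    (hfour : Integrable (fun x : ℝ => x ^ 4) F)
    (hneg :
      (∃ β : ℝ, 4 < β ∧ ∫⁻ x, ENNReal.ofReal x ^ (-β) ∂F < ∞) ∨
      (∃ m : ℕ, 4 ≤ m ∧
        ∫⁻ ω, (⨆ (n : ℕ) (_ : m ≤ n), ENNReal.ofReal
          (GiniSeq.jackVar (fun i => X i ω) n / GiniSeq.sampleMean (fun i => X i ω) n ^ 2)) ∂P < ∞ ∧
        ∫⁻ ω, (⨆ (n : ℕ) (_ : m ≤ n), ENNReal.ofReal
          (GiniSeq.sampleTau (fun i => X i ω) n / GiniSeq.sampleMean (fun i => X i ω) n ^ 2)) ∂P < ∞ ∧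
        ∫⁻ ω, (⨆ (n : ℕ) (_ : m ≤ n), ENNReal.ofReal
          (GiniSeq.sampleVar (fun i => X i ω) n / GiniSeq.sampleMean (fun i => X i ω) n ^ 2)) ∂P < ∞))
    (hxi : 0 < GiniSeq.xiSq F)
    (α : ℝ) (hα0 : 0 < α) (hα1 : α < 1) :
    (∀ᵐ ω ∂P, Tendsto
      (fun d : ℝ =>
        (GiniSeq.stopTime (GiniSeq.upperNormalQuantile (α / 2)) d (fun i => X i ω) : ℝ≥0∞) /
          (GiniSeq.optimalSize F (GiniSeq.upperNormalQuantile (α / 2)) d : ℝ≥0∞))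
      (𝓝[>] 0) (𝓝 1)) ∧
    Tendsto
      (fun d : ℝ => ∫⁻ ω,
        (GiniSeq.stopTime (GiniSeq.upperNormalQuantile (α / 2)) d (fun i => X i ω) : ℝ≥0∞) /
          (GiniSeq.optimalSize F (GiniSeq.upperNormalQuantile (α / 2)) d : ℝ≥0∞) ∂P)
      (𝓝[>] 0) (𝓝 1) := by
  have hF := GiniSeq.memLp_two_of_integrable_pow_four hfour
  -- A vanishing mean would make `xiSq F` vanish through its denominators.
  have hmean : GiniSeq.mean F ≠ 0 := by
    intro h
    simp [GiniSeq.xiSq, h] at hxi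
  have hz := GiniSeq.upperNormalQuantile_pos (p := α / 2) (by linarith) (by linarith)
  set z := GiniSeq.upperNormalQuantile (α / 2)
  have hratio : ∀ᵐ ω ∂P, Tendsto
      (fun d : ℝ => (GiniSeq.stopTime z d (fun i => X i ω) : ℝ≥0∞) /
        (GiniSeq.optimalSize F z d : ℝ≥0∞)) (𝓝[>] 0) (𝓝 1) :=
    (GiniSeq.ae_tendsto_sampleXiSq hX hindep hlaw hnonneg hF hmean).mono fun ω hω =>
      GiniSeq.tendsto_stopTime_div_optimalSize hz hxi hω
  refine ⟨hratio, ?_⟩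
  obtain ⟨m, hm, hfin⟩ : ∃ m : ℕ, 4 ≤ m ∧ ∫⁻ ω, (⨆ (n : ℕ) (_ : m ≤ n),
      ENNReal.ofReal (GiniSeq.sampleXiSq (fun i => X i ω) n)) ∂P < ∞ := by
    rcases hneg with ⟨β, hβ, hlint⟩ | ⟨m, hm, hJ, -, hS⟩
    · have hpos := GiniSeq.ae_pos_of_lintegral_rpow_neg (by linarith) hlint
      have hinv := GiniSeq.integrable_inv_sq_sq hβ hnonneg hlint
      refine ⟨4, le_rfl, GiniSeq.lintegral_iSup_sampleXiSq_lt_top hX hlaw hnonneg (by norm_num)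
        ?_ ?_⟩
      · exact GiniSeq.lintegral_iSup_lt_top_of_moments hX hindep hlaw hpos hfour hinv
          (by norm_num) (by norm_num) fun x hx n hn => GiniSeq.jackVar_le hx (by omega)
      · exact GiniSeq.lintegral_iSup_lt_top_of_moments hX hindep hlaw hpos hfour hinv
          (by norm_num) (by norm_num) fun x _ n hn => GiniSeq.sampleVar_le x (by omega)
    · exact ⟨m, hm, GiniSeq.lintegral_iSup_sampleXiSq_lt_top hX hlaw hnonneg (by omega) hJ hS⟩
  have hmeas : Measurable fun ω => ⨆ (n : ℕ) (_ : m ≤ n),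
      ENNReal.ofReal (GiniSeq.sampleXiSq (fun i => X i ω) n) :=
    Measurable.iSup fun n => Measurable.iSup fun _ =>
      (GiniSeq.measurable_sampleXiSq hX n).ennreal_ofReal
  have hdom := tendsto_lintegral_filter_of_dominated_convergence (μ := P) (l := 𝓝[>] (0 : ℝ))
    (F := fun d ω => (GiniSeq.stopTime z d (fun i => X i ω) : ℝ≥0∞) /
      (GiniSeq.optimalSize F z d : ℝ≥0∞)) (f := fun _ => 1)
    (fun ω => ENNReal.ofReal (m + 5 + 2 / GiniSeq.xiSq F) +
      ENNReal.ofReal (GiniSeq.xiSq F)⁻¹ * ⨆ (n : ℕ) (_ : m ≤ n),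
        ENNReal.ofReal (GiniSeq.sampleXiSq (fun i => X i ω) n))
    (Eventually.of_forall fun d =>
      ((measurable_of_countable ENat.toENNReal).comp
        (GiniSeq.measurable_stopTime hX z d)).div_const _) ?_ ?_ hratio
  · simpa using hdom
  · filter_upwards [self_mem_nhdsWithin, Ioc_mem_nhdsGT hz] with d hd hdz
    exact Eventually.of_forall fun ω =>
      GiniSeq.stopTime_div_optimalSize_le hz hd hdz.2 hxi m (by omega)
  · rw [lintegral_add_left measurable_const, lintegral_const_mul _ hmeas]
    simp only [lintegral_const, measure_univ, mul_one]
    exact (ENNReal.add_lt_top.2 ⟨ENNReal.ofReal_lt_top,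
      ENNReal.mul_lt_top ENNReal.ofReal_lt_top hfin⟩).ne
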